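/- \textbf{Proposition (Bi-planar Architecture).} For a positive integer $l$ let $S_l$ be the $l\times l$ cyclic shift matrix over $\mathbb{F}_2$, $(S_l)_{ij}=\delta_{j,(i+1)\bmod l}$. For positive integers $l,m$ put $x=S_l\otimes I_m$, $y=I_l\otimes S_m$, $z=S_l\otimes S_m$. A \emph{trivariate bicycle (TB-QLDPC) code} of weight $\mathcal W_A+\mathcal W_B$ is given by matrices $A=\sum_{j=1}^{\mathcal W_A}A_j$ and $B=\sum_{j=1}^{\mathcal W_B}B_j$ over $\mathbb{F}_2$, where each $A_j$ and each $B_j$ is a power of $x$, $y$ or $z$, the $A_j$ are pairwise distinct matrices, and the $B_j$ are pairwise distinct matrices. Its check matrices are $H_X=[A\,|\,B]$ and $H_Z=[B^{T}\,|\,A^{T}]$, and it has $n=2lm$ data qubits. Its \emph{Tanner graph} is the bipartite graph whose vertices are the checks (the rows of $H_X$ and of $H_Z$) and the data qubits (the columns), a check being joined to the data qubits at which its row is nonzero. A graph is \emph{planar} if it can be drawn in $\mathbb{R}^2$ with its vertices at distinct points and its edges as simple arcs between their endpoints, so that two different arcs meet only in endpoints and no arc passes through a vertex other than its own endpoints.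 The \emph{thickness} of a graph is the least number of planar subgraphs whose vertex sets together cover all vertices and whose edge sets partition the edge set. Let $(\mathcal W_A,\mathcal W_B)\in\{(2,2),(2,3),(3,3),(2,4)\}$. Then: (1) the Tanner graph of every TB-QLDPC code with $\mathcal W_A$ terms in $A$ and $\mathcal W_B$ terms in $B$ has thickness $2$; (2) a decomposition of the Tanner graph into two planar subgraphs can be computed in time $O(n)$: there are a program for a random access machine (with unit-cost addition, truncated subtraction, multiplication, division and remainder, indirect addressing, and an input and an output tape of words) and a constant $c$ such that, for every such code, given $l$, $m$ and, for each term of $A$ and of $B$, its variable and exponent, the program halts after at most $cn$ steps and has then written a list of all the edges of the Tanner graph, each exactly once and with a label in $\{0,1\}$, where for each label the edges with that label are the edges of a planar subgraph, the two subgraphs together containing every vertex; moreover all memory words that occur during the computation are at most $c$ times the sum of $n$ and all the input numbers. -/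

import Mathlib

open scoped Kronecker

/-! ## Trivariate bicycle codes -/

namespace TB

/-- The cyclic shift matrix `S_l` over `𝔽₂`: `(S_l)_{ij} = δ_{j, (i+1) mod l}`. -/
def shift (l : ℕ) : Matrix (Fin l) (Fin l) (ZMod 2) :=
  Matrix.of fun i j => if (j : ℕ) = ((i : ℕ) + 1) % l then 1 else 0

/-- The three variables of a trivariate bicycle code. -/
inductive Var
  | x
  | y
  | z

/-- `x = S_l ⊗ I_m`, `y = I_l ⊗ S_m`, `z = S_l ⊗ S_m`. -/
def Var.matrix (l m : ℕ) : Var → Matrix (Fin l × Fin m) (Fin l × Fin m) (ZMod 2)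
  | .x => shift l ⊗ₖ (1 : Matrix (Fin m) (Fin m) (ZMod 2))
  | .y => (1 : Matrix (Fin l) (Fin l) (ZMod 2)) ⊗ₖ shift m
  | .z => shift l ⊗ₖ shift m

/-- A term is a variable together with an exponent; its matrix is that power of the variable. -/
def termMatrix (l m : ℕ) (t : Var × ℕ) : Matrix (Fin l × Fin m) (Fin l × Fin m) (ZMod 2) :=
  (t.1.matrix l m) ^ t.2

/-- The Tanner graph of the CSS code with check matrices `HX`, `HZ`. The vertices are the checks
(rows of `HX` and rows of `HZ`) and the data qubits (columns); a check is joined to the data qubits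
on which its row is nonzero. -/
def cssTannerGraph {RX RZ D : Type*} (HX : Matrix RX D (ZMod 2)) (HZ : Matrix RZ D (ZMod 2)) :
    SimpleGraph ((RX ⊕ RZ) ⊕ D) where
  Adj
    | .inl c, .inr q => Matrix.fromRows HX HZ c q ≠ 0
    | .inr q, .inl c => Matrix.fromRows HX HZ c q ≠ 0
    | _, _ => False
  symm := ⟨fun u v h => by cases u <;> cases v <;> exact h⟩
  loopless := ⟨fun u h => by cases u <;> exact h⟩

end TB

/-- A trivariate bicycle code with parameters `l`, `m`, given by `wA` terms of `A` and `wB` terms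
of `B`, each a power of `x`, `y` or `z`; the terms of `A` are pairwise distinct matrices, and so are
the terms of `B`. Its weight is `wA + wB`. -/
structure TBCode (l m wA wB : ℕ) where
  aTerm : Fin wA → TB.Var × ℕ
  bTerm : Fin wB → TB.Var × ℕ
  aTerm_distinct : Function.Injective fun j => TB.termMatrix l m (aTerm j)
  bTerm_distinct : Function.Injective fun j => TB.termMatrix l m (bTerm j)

namespace TBCode

variable {l m wA wB : ℕ}

/-- `A = A_1 + ⋯ + A_{wA}`. -/
def A (C : TBCode l m wA wB) : Matrix (Fin l × Fin m) (Fin l × Fin m) (ZMod 2) :=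
  ∑ j, TB.termMatrix l m (C.aTerm j)

/-- `B = B_1 + ⋯ + B_{wB}`. -/
def B (C : TBCode l m wA wB) : Matrix (Fin l × Fin m) (Fin l × Fin m) (ZMod 2) :=
  ∑ j, TB.termMatrix l m (C.bTerm j)

/-- `H_X = [A | B]`. -/
def HX (C : TBCode l m wA wB) :
    Matrix (Fin l × Fin m) ((Fin l × Fin m) ⊕ (Fin l × Fin m)) (ZMod 2) :=
  Matrix.fromCols C.A C.B

/-- `H_Z = [Bᵀ | Aᵀ]`. -/
def HZ (C : TBCode l m wA wB) :
    Matrix (Fin l × Fin m) ((Fin l × Fin m) ⊕ (Fin l × Fin m)) (ZMod 2) :=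
  Matrix.fromCols C.B.transpose C.A.transpose

/-- The number of data qubits. -/
def n (_C : TBCode l m wA wB) : ℕ := 2 * l * m

/-- The vertices of the Tanner graph: (X-checks and Z-checks) and (L- and R-data qubits). -/
abbrev Vertex (l m : ℕ) : Type :=
  ((Fin l × Fin m) ⊕ (Fin l × Fin m)) ⊕ ((Fin l × Fin m) ⊕ (Fin l × Fin m))

def tannerGraph (C : TBCode l m wA wB) : SimpleGraph (Vertex l m) :=
  TB.cssTannerGraph C.HX C.HZ

end TBCode

/-! ## Planarity and thickness -/

/-- A simple graph is planar if its vertices can be placed at distinct points of the plane and its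
edges can be drawn as simple arcs joining their endpoints such that two different arcs meet only in
endpoints and no arc passes through a vertex other than its own endpoints. -/
def SimpleGraph.IsPlanar {V : Type*} (G : SimpleGraph V) : Prop :=
  ∃ (pos : V → EuclideanSpace ℝ (Fin 2))
    (arc : G.edgeSet → C(unitInterval, EuclideanSpace ℝ (Fin 2))),
    Function.Injective pos ∧
    (∀ e, Function.Injective (arc e)) ∧
    (∀ e, s(arc e 0, arc e 1) = (e : Sym2 V).map pos) ∧
    (∀ e f, e ≠ f → ∀ s t, arc e s = arc f t → (s = 0 ∨ s = 1) ∧ (t = 0 ∨ t = 1)) ∧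
    (∀ e t v, arc e t = pos v → v ∈ (e : Sym2 V))

/-- A family of planar subgraphs that together contain every vertex of `G` and whose edge sets
partition the edges of `G`. -/
def SimpleGraph.IsPlanarDecomposition {V : Type*} (G : SimpleGraph V) {k : ℕ}
    (S : Fin k → G.Subgraph) : Prop :=
  (∀ i, (S i).coe.IsPlanar) ∧
  (⋃ i, (S i).verts) = Set.univ ∧
  (⋃ i, (S i).edgeSet) = G.edgeSet ∧
  Pairwise fun i j => Disjoint (S i).edgeSet (S j).edgeSet

/-- The least number of planar subgraphs into which `G` can be decomposed (for a finite graph there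
always is such a decomposition). -/
noncomputable def SimpleGraph.thickness {V : Type*} (G : SimpleGraph V) : ℕ :=
  sInf {k : ℕ | ∃ S : Fin k → G.Subgraph, G.IsPlanarDecomposition S}

/-! ## Random access machines -/

namespace Ram

/-- Arithmetic operations on words (subtraction is truncated). -/
inductive Arith
  | add
  | sub
  | mul
  | div
  | mod

def Arith.eval : Arith → ℕ → ℕ → ℕ
  | .add, a, b => a + b
  | .sub, a, b => a - b
  | .mul, a, b => a * b
  | .div, a, b => a / b
  | .mod, a, b => a % b

/-- The instructions, acting on a memory `M` of words `M[0], M[1], …`, an input tape that is read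
word by word, and an output tape that is written word by word. -/
inductive Instr
  /-- `M[d] := k` -/
  | const (d k : ℕ)
  /-- `M[d] := M[a] o M[b]` -/
  | arith (o : Arith) (d a b : ℕ)
  /-- `M[d] := M[M[a]]` -/
  | load (d a : ℕ)
  /-- `M[M[a]] := M[b]` -/
  | store (a b : ℕ)
  /-- `M[d] :=` next input word (`0` when the input is exhausted) -/
  | read (d : ℕ)
  /-- append `M[a]` to the output -/
  | write (a : ℕ)
  /-- go to instruction number `q` if `M[a] = 0` -/
  | jumpIfZero (a q : ℕ)

abbrev Program : Type := List Instr

structure State where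
  pc : ℕ
  mem : ℕ → ℕ
  input : List ℕ
  output : List ℕ

/-- The state after executing one instruction. -/
def Instr.exec (s : State) : Instr → State
  | .const d k => { s with pc := s.pc + 1, mem := Function.update s.mem d k }
  | .arith o d a b =>
      { s with pc := s.pc + 1, mem := Function.update s.mem d (o.eval (s.mem a) (s.mem b)) }
  | .load d a => { s with pc := s.pc + 1, mem := Function.update s.mem d (s.mem (s.mem a)) }
  | .store a b => { s with pc := s.pc + 1, mem := Function.update s.mem (s.mem a) (s.mem b) }
  | .read d =>
      { s with
        pc := s.pc + 1
        mem := Function.update s.mem d (s.input.headD 0)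
        input := s.input.tail }
  | .write a => { s with pc := s.pc + 1, output := s.output ++ [s.mem a] }
  | .jumpIfZero a q => { s with pc := if s.mem a = 0 then q else s.pc + 1 }

/-- One step; the machine has halted once the program counter is beyond the program. -/
def step (P : Program) (s : State) : State :=
  match P[s.pc]? with
  | none => s
  | some i => i.exec s

/-- The state after `t` steps, started on the given input with all memory words `0`. -/
def run (P : Program) (input : List ℕ) (t : ℕ) : State :=
  (step P)^[t] ⟨0, fun _ => 0, input, []⟩

/-- On the given input, `P` halts after at most `T` steps with the given output, and all the words
ever held in memory are at most `W`. -/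
def RunsWithin (P : Program) (input output : List ℕ) (T W : ℕ) : Prop :=
  ∃ t ≤ T, P.length ≤ (run P input t).pc ∧ (run P input t).output = output ∧
    ∀ s ≤ t, ∀ a, (run P input s).mem a ≤ W

end Ram

/-! ## Input and output of the decomposition problem -/

def TB.Var.code : TB.Var → ℕ
  | .x => 0
  | .y => 1
  | .z => 2

namespace TBCode

variable {l m wA wB : ℕ}

/-- The description of a code as a list of numbers: `l`, `m`, and then for every term of `A` and
every term of `B` the variable and the exponent. -/
def input (C : TBCode l m wA wB) : List ℕ :=
  l :: m :: ((List.ofFn C.aTerm ++ List.ofFn C.bTerm).flatMap fun t => [t.1.code, t.2])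

/-- The number of a check (X-checks first) or of a data qubit (L-qubits first). -/
def index : (Fin l × Fin m) ⊕ (Fin l × Fin m) → ℕ
  | .inl p => p.1 * m + p.2
  | .inr p => l * m + (p.1 * m + p.2)

/-- The list `out` describes the family `S` of subgraphs: it is the concatenation of the triples
(check, data qubit, `i`), in some order and without repetition, one for every edge of every `S i`. -/
def IsOutput (C : TBCode l m wA wB) {k : ℕ} (S : Fin k → C.tannerGraph.Subgraph)
    (out : List ℕ) : Prop :=
  ∃ L : List (((Fin l × Fin m) ⊕ (Fin l × Fin m)) × ((Fin l × Fin m) ⊕ (Fin l × Fin m)) × Fin k),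
    L.Nodup ∧
    (∀ c q i, (c, q, i) ∈ L ↔ (S i).Adj (.inl c) (.inr q)) ∧
    out = L.flatMap fun e => [index e.1, index e.2.1, (e.2.2 : ℕ)]

end TBCode

/-! ## Winding numbers and non-planarity -/

namespace Winding

/-! A term is the permutation matrix of a translation of Γ = ℤ/l × ℤ/m. Distinct terms of `A` (or of
`B`) have disjoint supports, so nothing cancels modulo 2. The Tanner graph is therefore `groupGraph
A B` on four copies X, Z, L, R of Γ: X_i meets L_{i+a} and R_{i+b}, and Z_k meets L_{k-b} and
R_{k-a}.

Upper bound: label the terms 0 or 1 so that each label occurs at most twice on one side and at most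
once on the other (`PlanarLabels`). Up to translation and exchange of L and R, the edges with one
label lie in `groupGraph {0, a} {0}`. Over each coset of ⟨a⟩ this is a prism, an X-L cycle and a Z-R
cycle joined by spokes, and disjoint prisms can be drawn on concentric circles
(`Cylinder.isPlanar`).

Lower bound: two terms on each side already force nonplanarity. After translation A = {0, a} and B =
{0, b} with a, b nonzero, and exchanging the two terms of B disposes of b = -a. If b = a, or b is
another multiple of a, there is a K₃,₃ minor; if b is not in ⟨a⟩, there is a K₅ minor.

That K₅ and K₃,₃ minors obstruct planarity is shown with winding numbers. For disjoint curves γ and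
δ, the function γ s - δ t has a continuous logarithm on the whole parameter plane. Its changes along
the four sides of the unit square cancel, which gives a linear equation between integers for each
pair of independent edges (`Winding.exists_winding_system`). For K₅ and K₃,₃ these equations are
inconsistent modulo 2.

Algorithm: the labels depend only on the two weights, so they are built into the program. It visits
the l m positions and prints two edges per term, with a bounded number of instructions per position.
-/

theorem exists_continuous_log {X : Type*} [TopologicalSpace X] [SimplyConnectedSpace X]
    [LocallyPathConnectedSpace X] {g : X → ℂ} (hg : Continuous g) (h0 : ∀ x, g x ≠ 0) :
    ∃ f : X → ℂ, Continuous f ∧ ∀ x, Complex.exp (f x) = g x := by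
  obtain ⟨x₀⟩ : Nonempty X := inferInstance
  obtain ⟨F, ⟨-, hF⟩, -⟩ := Complex.isCoveringMapOn_exp.existsUnique_continuousMap_lifts
    ⟨g, hg⟩ (a₀ := x₀) (Complex.exp_log (h0 x₀)) (fun x => h0 x)
  exact ⟨F, F.continuous, fun x => congrFun hF x⟩

/-- The change along `[0, 1]` of a continuous logarithm of `g`. -/
noncomputable def logChange (g : ℝ → ℂ) : ℂ :=
  open Classical in
  if h : ∃ f : ℝ → ℂ, Continuous f ∧ ∀ x, Complex.exp (f x) = g x then
    h.choose 1 - h.choose 0 else 0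

/-- Two continuous logarithms of the same function differ by a continuous function with values in
2πiℤ, which is constant on the line. Hence the choice made in `logChange` is immaterial. -/
theorem logChange_eq {f g : ℝ → ℂ} (hf : Continuous f) (h : ∀ x, Complex.exp (f x) = g x) :
    logChange g = f 1 - f 0 := by
  have hex : ∃ f : ℝ → ℂ, Continuous f ∧ ∀ x, Complex.exp (f x) = g x := ⟨f, hf, h⟩
  obtain ⟨hc, he⟩ := hex.choose_spec
  rw [logChange, dif_pos hex]
  set f' := hex.choose
  have hone : ∀ x, Complex.exp (f x - f' x) = 1 := fun x => by
    rw [Complex.exp_sub, h, he, div_self]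
    rw [← h]; exact Complex.exp_ne_zero _
  have hint : ∀ x, ∃ k : ℤ, f x - f' x = k * (2 * Real.pi * Complex.I) := fun x =>
    Complex.exp_eq_one_iff.1 (hone x)
  choose k hk using hint
  have hkr : ∀ x, (k x : ℝ) = ((f x - f' x) / (2 * Real.pi * Complex.I)).re := fun x => by
    rw [hk, mul_div_cancel_right₀ _ Complex.two_pi_I_ne_zero, Complex.intCast_re]
  have hkc : Continuous fun x => (k x : ℝ) := by
    simp_rw [hkr]
    exact Complex.continuous_re.comp ((hf.sub hc).div_const _)
  have hk' : Continuous k := (Int.isClosedEmbedding_coe_real.isInducing.continuous_iff).2 hkc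
  have hconst : k 1 = k 0 :=
    (isPreconnected_univ.constant hk'.continuousOn (Set.mem_univ _) (Set.mem_univ _))
  have h1 := hk 1
  have h0 := hk 0
  rw [hconst, ← h0] at h1
  linear_combination -h1

theorem exp_logChange {g : ℝ → ℂ} (hg : Continuous g) (h0 : ∀ x, g x ≠ 0) :
    Complex.exp (logChange g) = g 1 / g 0 := by
  obtain ⟨f, hf, h⟩ := exists_continuous_log hg h0
  rw [logChange_eq hf h, Complex.exp_sub, h, h]

/-- The change of logarithm of `γ s - δ t` around the boundary of the unit square is zero. -/
theorem logChange_square {γ δ : ℝ → ℂ} (hγ : Continuous γ) (hδ : Continuous δ)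
    (h : ∀ s t, γ s ≠ δ t) :
    logChange (fun s => γ s - δ 0) + logChange (fun t => δ t - γ 1) =
      logChange (fun s => γ s - δ 1) + logChange (fun t => δ t - γ 0) := by
  obtain ⟨F, hF, hexp⟩ := exists_continuous_log (X := ℝ × ℝ) (g := fun p => γ p.1 - δ p.2)
    (by fun_prop) (fun p => sub_ne_zero.2 (h _ _))
  have hs : ∀ t, logChange (fun s => γ s - δ t) = F (1, t) - F (0, t) := fun t =>
    logChange_eq (f := fun s => F (s, t)) (by fun_prop) (fun s => hexp (s, t))
  have ht : ∀ s, logChange (fun t => δ t - γ s) = F (s, 1) - F (s, 0) := fun s => by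
    -- Adding πi turns a logarithm of γ s - δ t into one of δ t - γ s; the constant drops out of the
    -- change.
    rw [logChange_eq (f := fun t => F (s, t) + Real.pi * Complex.I) (by fun_prop) (fun t => by
      rw [Complex.exp_add, Complex.exp_pi_mul_I, hexp]; ring)]
    ring
  rw [hs, hs, ht, ht]
  ring

/-- A logarithm of `P v - P u`, chosen so that exchanging `u < v` adds `π i`. -/
noncomputable def dirLog {n : ℕ} (P : Fin n → ℂ) (u v : Fin n) : ℂ :=
  if u < v then Complex.log (P v - P u) else Complex.log (P u - P v) + Real.pi * Complex.I

theorem exp_dirLog {n : ℕ} {P : Fin n → ℂ} {u v : Fin n} (h : P u ≠ P v) :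
    Complex.exp (dirLog P u v) = P v - P u := by
  unfold dirLog
  split_ifs
  · exact Complex.exp_log (sub_ne_zero.2 h.symm)
  · rw [Complex.exp_add, Complex.exp_pi_mul_I, Complex.exp_log (sub_ne_zero.2 h)]
    ring

theorem dirLog_sub {n : ℕ} (P : Fin n → ℂ) {u v : Fin n} (h : u ≠ v) :
    dirLog P u v - dirLog P v u =
      ((1 - 2 * (if u < v then 1 else 0 : ℤ) : ℤ) : ℂ) * (Real.pi * Complex.I) := by
  unfold dirLog
  rcases lt_or_gt_of_ne h with h | h
  · simp [h, h.not_gt]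
  · simp [h, h.not_gt]

/-- Disjointness of the curves drawn for independent edges, as a linear system over `ℤ`; the right
side is the parity of the crossing of the two edges in a drawing with vertices in convex position. -/
theorem exists_winding_system {n : ℕ} (E : Fin n → Fin n → Prop) (P : Fin n → ℂ)
    (γ : Fin n → Fin n → ℝ → ℂ) (hc : ∀ a b, E a b → Continuous (γ a b))
    (h0 : ∀ a b, E a b → γ a b 0 = P a) (h1 : ∀ a b, E a b → γ a b 1 = P b)
    (hd : ∀ a b c d, E a b → E c d → a ≠ c → a ≠ d → b ≠ c → b ≠ d →
      ∀ s t, γ a b s ≠ γ c d t) :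
    ∃ k : Fin n → Fin n → Fin n → ℤ, ∀ a b c d, E a b → E c d → a ≠ c → a ≠ d → b ≠ c → b ≠ d →
      k d a b - k c a b - k b c d + k a c d =
        (if d < b then 1 else 0) - (if d < a then 1 else 0) - (if c < b then 1 else 0)
          + (if c < a then 1 else 0) := by
  -- The integer counts the full turns of the curve around `P v` in excess of the reference change
  -- given by `dirLog`. It is 0 by convention when there is no such curve or when the curve meets `P
  -- v`.
  have hk : ∀ v a b, ∃ k : ℤ, E a b → (∀ s, γ a b s ≠ P v) →
      logChange (fun s => γ a b s - P v) =
        dirLog P v b - dirLog P v a + k * (2 * Real.pi * Complex.I) := by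
    intro v a b
    by_cases h : E a b ∧ ∀ s, γ a b s ≠ P v
    · obtain ⟨hE, hv⟩ := h
      have ha : P v ≠ P a := by rw [← h0 a b hE]; exact (hv 0).symm
      have hb : P v ≠ P b := by rw [← h1 a b hE]; exact (hv 1).symm
      have hexp : Complex.exp (logChange fun s => γ a b s - P v) =
          Complex.exp (dirLog P v b - dirLog P v a) := by
        have := hc a b hE
        rw [exp_logChange (by fun_prop) (fun s => sub_ne_zero.2 (hv s)), Complex.exp_sub,
          exp_dirLog ha, exp_dirLog hb, h0 a b hE, h1 a b hE]
      obtain ⟨k, hk⟩ := Complex.exp_eq_exp_iff_exists_int.1 hexp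
      exact ⟨k, fun _ _ => hk⟩
    · exact ⟨0, fun h1 h2 => absurd ⟨h1, h2⟩ h⟩
  choose k hk using hk
  refine ⟨k, fun a b c d hab hcd hac had hbc hbd => ?_⟩
  have hdis := hd a b c d hab hcd hac had hbc hbd
  have hsq := logChange_square (hc a b hab) (hc c d hcd) hdis
  rw [h0 a b hab, h1 a b hab, h0 c d hcd, h1 c d hcd] at hsq
  rw [hk c a b hab (fun s => by rw [← h0 c d hcd]; exact hdis s 0),
    hk d a b hab (fun s => by rw [← h1 c d hcd]; exact hdis s 1),
    hk a c d hcd (fun s => by rw [← h0 a b hab]; exact (hdis 0 s).symm),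
    hk b c d hcd (fun s => by rw [← h1 a b hab]; exact (hdis 1 s).symm)] at hsq
  have e1 := dirLog_sub P hac.symm
  have e2 := dirLog_sub P had.symm
  have e3 := dirLog_sub P hbc.symm
  have e4 := dirLog_sub P hbd.symm
  have hpi : (2 * Real.pi * Complex.I) ≠ 0 := Complex.two_pi_I_ne_zero
  rw [← Int.cast_inj (α := ℂ), ← mul_left_inj' hpi]
  push_cast at e1 e2 e3 e4 ⊢
  -- The `dirLog` terms of the square identity pair up into differences under exchange of the two
  -- points. Each is an odd multiple of πi, which produces the order indicators on the right.
  linear_combination -hsq - e1 + e2 + e3 - e4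

end Winding

/-! ### Minors of planar graphs -/

namespace SimpleGraph

variable {V W : Type*}

/-- Disjoint connected branch sets in `G`, with edges between the sets of `E`-related indices. -/
structure IsMinorModel (G : SimpleGraph V) {n : ℕ} (E : Fin n → Fin n → Prop)
    (B : Fin n → Set V) (c : Fin n → V) : Prop where
  center_mem : ∀ i, c i ∈ B i
  disjoint : ∀ i j v, v ∈ B i → v ∈ B j → i = j
  connected : ∀ i, ∀ v ∈ B i, Relation.ReflTransGen (fun u w => G.Adj u w ∧ w ∈ B i) (c i) v
  adj : ∀ i j, E i j → ∃ u ∈ B i, ∃ v ∈ B j, G.Adj u v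

/-- Contracting the branch sets is avoided: an edge of the minor is realised by a path in the
drawing that stays in its two branch sets and the arcs inside them. Independent edges of the minor
then get disjoint paths. -/
theorem IsMinorModel.exists_winding_system {G : SimpleGraph V} {n : ℕ}
    {E : Fin n → Fin n → Prop} {B : Fin n → Set V} {c : Fin n → V} (h : G.IsMinorModel E B c)
    (hG : G.IsPlanar) :
    ∃ k : Fin n → Fin n → Fin n → ℤ, ∀ a b c d, E a b → E c d → a ≠ c → a ≠ d → b ≠ c → b ≠ d →
      k d a b - k c a b - k b c d + k a c d =
        (if d < b then 1 else 0) - (if d < a then 1 else 0) - (if c < b then 1 else 0)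
          + (if c < a then 1 else 0) := by
  obtain ⟨pos, arc, hinj, -, hends, hcross, hvert⟩ := hG
  have hend : ∀ (e : G.edgeSet) (t : unitInterval), t = 0 ∨ t = 1 → ∃ v ∈ (e : Sym2 V),
      arc e t = pos v := by
    intro e t ht
    have : arc e t ∈ s(arc e 0, arc e 1) := by
      rcases ht with rfl | rfl <;> simp
    rw [hends, Sym2.mem_map] at this
    obtain ⟨v, hv, hv'⟩ := this
    exact ⟨v, hv, hv'.symm⟩
  -- The part of the drawing that belongs to the subgraph induced on the two branch sets.
  let T : Fin n → Fin n → Set (EuclideanSpace ℝ (Fin 2)) := fun a b =>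
    {x | (∃ e : G.edgeSet, (∀ v ∈ (e : Sym2 V), v ∈ B a ∪ B b) ∧ ∃ t, arc e t = x) ∨
      ∃ v ∈ B a ∪ B b, pos v = x}
  have hTpos : ∀ a b v, v ∈ B a ∪ B b → pos v ∈ T a b := fun a b v hv => Or.inr ⟨v, hv, rfl⟩
  have hTadj : ∀ a b u v, u ∈ B a ∪ B b → v ∈ B a ∪ B b → G.Adj u v →
      JoinedIn (T a b) (pos u) (pos v) := by
    intro a b u v hu hv huv
    let e : G.edgeSet := ⟨s(u, v), huv⟩
    have hj : JoinedIn (T a b) (arc e 0) (arc e 1) :=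
      ⟨⟨arc e, rfl, rfl⟩, fun t => Or.inl ⟨e, fun w hw => by
        rcases Sym2.mem_iff.1 hw with rfl | rfl <;> assumption, t, rfl⟩⟩
    have := hends e
    rw [Sym2.map_mk, Sym2.eq_iff] at this
    rcases this with ⟨h0, h1⟩ | ⟨h0, h1⟩
    · rwa [h0, h1] at hj
    · rw [h0, h1] at hj; exact hj.symm
  have hTcon : ∀ a b i, B i ⊆ B a ∪ B b → ∀ v ∈ B i, JoinedIn (T a b) (pos (c i)) (pos v) := by
    intro a b i hi v hv
    have := h.connected i v hv
    clear hv
    have key : v ∈ B i ∧ JoinedIn (T a b) (pos (c i)) (pos v) := by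
      induction this with
      | refl => exact ⟨h.center_mem i, JoinedIn.refl (hTpos _ _ _ (hi (h.center_mem i)))⟩
      | tail _ huv ih =>
        exact ⟨huv.2, ih.2.trans (hTadj a b _ _ (hi ih.1) (hi huv.2) huv.1)⟩
    exact key.2
  have hTjoin : ∀ a b, E a b → JoinedIn (T a b) (pos (c a)) (pos (c b)) := by
    intro a b hab
    obtain ⟨u, hu, v, hv, huv⟩ := h.adj a b hab
    exact (hTcon a b a Set.subset_union_left u hu).trans
      ((hTadj a b u v (Or.inl hu) (Or.inr hv) huv).trans
        (hTcon a b b Set.subset_union_right v hv).symm)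
  have hTdis : ∀ a b c d, a ≠ c → a ≠ d → b ≠ c → b ≠ d → ∀ x ∈ T a b, x ∉ T c d := by
    intro a b c d hac had hbc hbd
    have hBd : ∀ v, v ∈ B a ∪ B b → v ∉ B c ∪ B d := by
      rintro v (hv | hv) (hw | hw)
      · exact hac (h.disjoint _ _ v hv hw)
      · exact had (h.disjoint _ _ v hv hw)
      · exact hbc (h.disjoint _ _ v hv hw)
      · exact hbd (h.disjoint _ _ v hv hw)
    rintro x (⟨e, he, t, rfl⟩ | ⟨v, hv, rfl⟩) (⟨f, hf, s, hfs⟩ | ⟨w, hw, hwx⟩)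
    · by_cases hef : e = f
      · obtain ⟨v, hv, -⟩ := hend e 0 (Or.inl rfl)
        exact hBd v (he v hv) (hf v (hef ▸ hv))
      · obtain ⟨h1, h2⟩ := hcross e f hef t s hfs.symm
        obtain ⟨v, hv, hv'⟩ := hend e t h1
        obtain ⟨w, hw, hw'⟩ := hend f s h2
        have : v = w := hinj (by rw [← hv', ← hw', hfs])
        exact hBd v (he v hv) (this ▸ hf w hw)
    · exact hBd w (he w (hvert e t w hwx.symm)) hw
    · exact hBd v hv (hf v (hvert f s v hfs))
    · exact hBd v hv (hinj hwx ▸ hw)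
  let Φ : EuclideanSpace ℝ (Fin 2) → ℂ := fun x => ⟨x 0, x 1⟩
  have hΦ : Continuous Φ := by
    have : Φ = fun x => Complex.equivRealProdCLM.symm (x 0, x 1) := by
      rfl
    rw [this]
    fun_prop
  have hΦi : Function.Injective Φ := by
    intro x y hxy
    rw [Complex.ext_iff] at hxy
    ext i
    fin_cases i
    · exact hxy.1
    · exact hxy.2
  classical
  -- Extending a path by constants to the real line keeps all its values in `T a b`, so disjointness
  -- holds for all real parameters. The value 0 for non-edges is never used.
  let γ : Fin n → Fin n → ℝ → ℂ := fun a b t =>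
    if hab : E a b then Φ ((hTjoin a b hab).somePath.extend t) else 0
  have hγ : ∀ a b (hab : E a b), γ a b = fun t => Φ ((hTjoin a b hab).somePath.extend t) :=
    fun a b hab => by funext t; simp only [γ, dif_pos hab]
  refine Winding.exists_winding_system E (fun i => Φ (pos (c i))) γ ?_ ?_ ?_ ?_
  · intro a b hab
    rw [hγ a b hab]
    exact hΦ.comp (Path.continuous_extend _)
  · intro a b hab
    rw [hγ a b hab]
    simp
  · intro a b hab
    rw [hγ a b hab]
    simp
  · intro a b c d hab hcd hac had hbc hbd s t heq
    rw [hγ a b hab, hγ c d hcd] at heq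
    refine hTdis a b c d hac had hbc hbd _ ((hTjoin a b hab).somePath_mem
      (Set.projIcc 0 1 zero_le_one s)) ?_
    have h2 := (hTjoin c d hcd).somePath_mem (Set.projIcc 0 1 zero_le_one t)
    have h3 := hΦi heq
    exact (congrArg (· ∈ T c d) h3).mpr h2

/-- Add the equations of the 15 pairs of independent edges. Each unknown `k v a b` occurs in two of
them, once for each remaining vertex joined to `v`, so the left side is even. The right side has the
parity of the number of crossings of a convex drawing of K₅, which is 5. -/
theorem not_isPlanar_of_completeGraph_five {G : SimpleGraph V} {B : Fin 5 → Set V}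
    {c : Fin 5 → V} (h : G.IsMinorModel (fun i j => i < j) B c) : ¬ G.IsPlanar := by
  intro hG
  obtain ⟨k, hk⟩ := h.exists_winding_system hG
  replace hk := fun a b c d (h : (_ ∧ _) ∧ a ≠ c ∧ a ≠ d ∧ b ≠ c ∧ b ≠ d) =>
    hk a b c d h.1.1 h.1.2 h.2.1 h.2.2.1 h.2.2.2.1 h.2.2.2.2
  have e1 := hk 0 1 2 3 (by decide)
  have e2 := hk 0 1 2 4 (by decide)
  have e3 := hk 0 1 3 4 (by decide)
  have e4 := hk 0 2 1 3 (by decide)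
  have e5 := hk 0 2 1 4 (by decide)
  have e6 := hk 0 2 3 4 (by decide)
  have e7 := hk 0 3 1 2 (by decide)
  have e8 := hk 0 3 1 4 (by decide)
  have e9 := hk 0 3 2 4 (by decide)
  have e10 := hk 0 4 1 2 (by decide)
  have e11 := hk 0 4 1 3 (by decide)
  have e12 := hk 0 4 2 3 (by decide)
  have e13 := hk 1 2 3 4 (by decide)
  have e14 := hk 1 3 2 4 (by decide)
  have e15 := hk 1 4 2 3 (by decide)
  simp +decide only [if_true, if_false] at e1 e2 e3 e4 e5 e6 e7 e8 e9 e10 e11 e12 e13 e14 e15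
  omega

/-- The complete bipartite graph with parts `{0, 1, 2}` and `{3, 4, 5}`. -/
theorem not_isPlanar_of_completeBipartite_three {G : SimpleGraph V} {B : Fin 6 → Set V}
    {c : Fin 6 → V} (h : G.IsMinorModel (fun i j => i < 3 ∧ 3 ≤ j) B c) : ¬ G.IsPlanar := by
  intro hG
  obtain ⟨k, hk⟩ := h.exists_winding_system hG
  replace hk := fun a b c d (h : (_ ∧ _) ∧ a ≠ c ∧ a ≠ d ∧ b ≠ c ∧ b ≠ d) =>
    hk a b c d h.1.1 h.1.2 h.2.1 h.2.2.1 h.2.2.2.1 h.2.2.2.2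
  have e1 := hk 0 3 1 4 (by decide)
  have e2 := hk 0 3 1 5 (by decide)
  have e3 := hk 0 3 2 4 (by decide)
  have e4 := hk 0 3 2 5 (by decide)
  have e5 := hk 0 4 1 3 (by decide)
  have e6 := hk 0 4 1 5 (by decide)
  have e7 := hk 0 4 2 3 (by decide)
  have e8 := hk 0 4 2 5 (by decide)
  have e9 := hk 0 5 1 3 (by decide)
  have e10 := hk 0 5 1 4 (by decide)
  have e11 := hk 0 5 2 3 (by decide)
  have e12 := hk 0 5 2 4 (by decide)
  have e13 := hk 1 3 2 4 (by decide)
  have e14 := hk 1 3 2 5 (by decide)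
  have e15 := hk 1 4 2 3 (by decide)
  have e16 := hk 1 4 2 5 (by decide)
  have e17 := hk 1 5 2 3 (by decide)
  have e18 := hk 1 5 2 4 (by decide)
  simp +decide only [if_true, if_false] at e1 e2 e3 e4 e5 e6 e7 e8 e9 e10 e11 e12 e13 e14 e15 e16 e17 e18
  -- As for K₅: each unknown occurs in two of the 18 equations, whereas the convex drawing with the
  -- parts on consecutive points has 9 crossings.
  omega

end SimpleGraph

/-! ## The Tanner graph in terms of a finite abelian group -/

namespace TB

variable {Γ : Type*} [AddCommGroup Γ]

abbrev vX (i : Γ) : (Γ ⊕ Γ) ⊕ (Γ ⊕ Γ) := .inl (.inl i)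

abbrev vZ (i : Γ) : (Γ ⊕ Γ) ⊕ (Γ ⊕ Γ) := .inl (.inr i)

abbrev vL (i : Γ) : (Γ ⊕ Γ) ⊕ (Γ ⊕ Γ) := .inr (.inl i)

abbrev vR (i : Γ) : (Γ ⊕ Γ) ⊕ (Γ ⊕ Γ) := .inr (.inr i)

/-- Incidence of checks and data qubits when the terms of `A` and `B` translate by the elements of
`A` and `B`. -/
def Incident (A B : Set Γ) : Γ ⊕ Γ → Γ ⊕ Γ → Prop
  | .inl i, .inl j => j - i ∈ A
  | .inl i, .inr j => j - i ∈ B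
  | .inr k, .inl j => k - j ∈ B
  | .inr k, .inr j => k - j ∈ A

def groupGraph (A B : Set Γ) : SimpleGraph ((Γ ⊕ Γ) ⊕ (Γ ⊕ Γ)) where
  Adj
    | .inl c, .inr q => Incident A B c q
    | .inr q, .inl c => Incident A B c q
    | _, _ => False
  symm := ⟨fun u v h => by cases u <;> cases v <;> exact h⟩
  loopless := ⟨fun u h => by cases u <;> exact h⟩

theorem groupGraph_mono {A B A' B' : Set Γ} (hA : A ⊆ A') (hB : B ⊆ B') :
    groupGraph A B ≤ groupGraph A' B' := by
  rintro ((u | u) | (u | u)) ((v | v) | (v | v)) h <;> first | exact hA h | exact hB h | exact h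

/-- Translating `A` and `B` does not change the graph up to isomorphism. -/
def groupGraphTranslate (A B : Set Γ) (α β : Γ) :
    groupGraph ((α + ·) ⁻¹' A) ((β + ·) ⁻¹' B) →g groupGraph A B where
  toFun
    | .inl (.inl i) => vX i
    | .inl (.inr i) => vZ (α + β + i)
    | .inr (.inl i) => vL (α + i)
    | .inr (.inr i) => vR (β + i)
  map_rel' := by
    rintro ((u | u) | (u | u)) ((v | v) | (v | v)) h <;>
      simp only [groupGraph, Incident, Set.mem_preimage] at h ⊢ <;>
      convert h using 1 <;> abel

theorem groupGraphTranslate_injective (A B : Set Γ) (α β : Γ) :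
    Function.Injective (groupGraphTranslate A B α β) := by
  rintro ((u | u) | (u | u)) ((v | v) | (v | v)) h <;>
    simp_all [groupGraphTranslate]

def groupGraphSwap (A B : Set Γ) : groupGraph A B →g groupGraph B A where
  toFun
    | .inl c => .inl c
    | .inr (.inl i) => vR i
    | .inr (.inr i) => vL i
  map_rel' := by
    rintro ((u | u) | (u | u)) ((v | v) | (v | v)) h <;> exact h

theorem groupGraphSwap_injective (A B : Set Γ) : Function.Injective (groupGraphSwap A B) := by
  rintro ((u | u) | (u | u)) ((v | v) | (v | v)) h <;>
    simp_all [groupGraphSwap]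

end TB

namespace SimpleGraph

theorem IsPlanar.of_hom {V W : Type*} {G : SimpleGraph V} {H : SimpleGraph W} (hH : H.IsPlanar)
    (f : G →g H) (hf : Function.Injective f) : G.IsPlanar := by
  obtain ⟨pos, arc, h1, h2, h3, h4, h5⟩ := hH
  let φ : G.edgeSet → H.edgeSet := f.mapEdgeSet
  have hφ : Function.Injective φ := Hom.mapEdgeSet.injective f hf
  refine ⟨pos ∘ f, arc ∘ φ, h1.comp hf, fun e => h2 _, fun e => ?_, fun e e' h => ?_,
    fun e t v h => ?_⟩
  · rw [Function.comp_apply, h3, ← Sym2.map_map]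
    rfl
  · exact h4 _ _ (fun h' => h (hφ h'))
  · have := h5 _ _ _ h
    have h6 : ((φ e : H.edgeSet) : Sym2 W) = (e : Sym2 V).map f := rfl
    rw [h6, Sym2.mem_map] at this
    obtain ⟨w, hw, hw'⟩ := this
    exact hf hw' ▸ hw

end SimpleGraph

/-! ### Nonplanarity with two translations on each side -/

namespace TB

variable {Γ : Type*} [AddCommGroup Γ]

/-- The closed walk `X_0, L_a, X_a, L_{2a}, …`. -/
def cyc (a : Γ) (n : ℕ) : (Γ ⊕ Γ) ⊕ (Γ ⊕ Γ) :=
  if n % 2 = 0 then vX ((n / 2) • a) else vL ((n / 2 + 1) • a)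

theorem cyc_even (a : Γ) (n : ℕ) : cyc a (2 * n) = vX (n • a) := by
  rw [cyc, if_pos (by omega)]
  congr 3
  omega

theorem cyc_odd (a : Γ) (n : ℕ) : cyc a (2 * n + 1) = vL ((n + 1) • a) := by
  rw [cyc, if_neg (by omega)]
  congr 4
  omega

theorem cyc_adj {a : Γ} {A B : Set Γ} (h0 : (0 : Γ) ∈ A) (ha : a ∈ A) (n : ℕ) :
    (groupGraph A B).Adj (cyc a n) (cyc a (n + 1)) := by
  obtain ⟨k, rfl | rfl⟩ := Nat.even_or_odd' n
  · rw [cyc_even, cyc_odd]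
    change (k + 1) • a - k • a ∈ A
    rwa [succ_nsmul, add_sub_cancel_left]
  · rw [cyc_odd, show 2 * k + 1 + 1 = 2 * (k + 1) by ring, cyc_even]
    change (k + 1) • a - (k + 1) • a ∈ A
    rwa [sub_self]

theorem cyc_add_two_mul (a : Γ) (n : ℕ) : cyc a (n + 2 * addOrderOf a) = cyc a n := by
  obtain ⟨k, rfl | rfl⟩ := Nat.even_or_odd' n
  · rw [← mul_add, cyc_even, cyc_even, add_nsmul, addOrderOf_nsmul_eq_zero, add_zero]
  · rw [show 2 * k + 1 + 2 * addOrderOf a = 2 * (k + addOrderOf a) + 1 by ring, cyc_odd, cyc_odd,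
      show k + addOrderOf a + 1 = k + 1 + addOrderOf a by ring, add_nsmul,
      addOrderOf_nsmul_eq_zero, add_zero]

theorem cyc_injOn {a : Γ} {n k : ℕ} (hn : n < 2 * addOrderOf a) (hk : k < 2 * addOrderOf a)
    (h : cyc a n = cyc a k) : n = k := by
  obtain ⟨n, rfl | rfl⟩ := Nat.even_or_odd' n <;> obtain ⟨k, rfl | rfl⟩ := Nat.even_or_odd' k
  · rw [cyc_even, cyc_even] at h
    have := nsmul_injOn_Iio_addOrderOf (x := a) (Set.mem_Iio.2 (by omega : n < _))
      (Set.mem_Iio.2 (by omega : k < _)) (by simpa using h)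
    omega
  · rw [cyc_even, cyc_odd] at h
    simp at h
  · rw [cyc_even, cyc_odd] at h
    simp at h
  · rw [cyc_odd, cyc_odd] at h
    have := nsmul_injOn_Iio_addOrderOf (x := a) (Set.mem_Iio.2 (by omega : n < _))
      (Set.mem_Iio.2 (by omega : k < _)) (by simpa [succ_nsmul] using h)
    omega

theorem cyc_reach {a : Γ} {A B : Set Γ} (h0 : (0 : Γ) ∈ A) (ha : a ∈ A)
    {S : Set ((Γ ⊕ Γ) ⊕ (Γ ⊕ Γ))} {p n : ℕ} (hpn : p ≤ n)
    (hS : ∀ k, p < k → k ≤ n → cyc a k ∈ S) :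
    Relation.ReflTransGen (fun u w => (groupGraph A B).Adj u w ∧ w ∈ S) (cyc a p) (cyc a n) := by
  induction n, hpn using Nat.le_induction with
  | base => exact .refl
  | succ n hn ih =>
    exact (ih fun k h1 h2 => hS k h1 (by omega)).tail ⟨cyc_adj h0 ha n, hS _ (by omega) le_rfl⟩

theorem exists_nsmul_of_mem_zmultiples [Finite Γ] {a g : Γ} (h : g ∈ AddSubgroup.zmultiples a) :
    ∃ n < addOrderOf a, n • a = g := by
  classical
  have := mem_zmultiples_iff_mem_range_addOrderOf.1 h
  simpa using this

theorem cyc_cases (a : Γ) (n : ℕ) :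
    ∃ g ∈ AddSubgroup.zmultiples a, cyc a n = vX g ∨ cyc a n = vL g := by
  obtain ⟨k, rfl | rfl⟩ := Nat.even_or_odd' n
  · exact ⟨_, AddSubgroup.nsmul_mem_zmultiples a k, .inl (cyc_even a k)⟩
  · exact ⟨_, AddSubgroup.nsmul_mem_zmultiples a (k + 1), .inr (cyc_odd a k)⟩

/-- The vertices `cyc a k` with `p ≤ k < q`. -/
def cycSeg (a : Γ) (p q : ℕ) : Set ((Γ ⊕ Γ) ⊕ (Γ ⊕ Γ)) := {v | ∃ k, p ≤ k ∧ k < q ∧ cyc a k = v}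

theorem cycSeg_disjoint {a : Γ} {p q p' q' : ℕ} (h : q ≤ p') (hq : q' ≤ 2 * addOrderOf a)
    {v : (Γ ⊕ Γ) ⊕ (Γ ⊕ Γ)} (hv : v ∈ cycSeg a p q) (hv' : v ∈ cycSeg a p' q') : False := by
  obtain ⟨k, h1, h2, rfl⟩ := hv
  obtain ⟨k', h1', h2', h3⟩ := hv'
  have := cyc_injOn (by omega) (by omega) h3
  omega

theorem cyc_mem_cycSeg {a : Γ} {p q k : ℕ} (h1 : p ≤ k) (h2 : k < q) : cyc a k ∈ cycSeg a p q :=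
  ⟨k, h1, h2, rfl⟩

theorem cycSeg_reach {a : Γ} {A B : Set Γ} (h0 : (0 : Γ) ∈ A) (ha : a ∈ A)
    {S : Set ((Γ ⊕ Γ) ⊕ (Γ ⊕ Γ))} {p q : ℕ} (hS : cycSeg a p q ⊆ S) {v} (hv : v ∈ cycSeg a p q) :
    Relation.ReflTransGen (fun u w => (groupGraph A B).Adj u w ∧ w ∈ S) (cyc a p) v := by
  obtain ⟨k, h1, h2, rfl⟩ := hv
  exact cyc_reach h0 ha h1 fun j hj hj' => hS (cyc_mem_cycSeg hj.le (by omega))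

theorem vR_not_mem_cycSeg {a g : Γ} {p q : ℕ} : vR g ∉ cycSeg a p q := by
  rintro ⟨k, -, -, h⟩
  obtain ⟨g', -, h' | h'⟩ := cyc_cases a k <;> rw [h'] at h <;> simp at h

theorem vZ_not_mem_cycSeg {a g : Γ} {p q : ℕ} : vZ g ∉ cycSeg a p q := by
  rintro ⟨k, -, -, h⟩
  obtain ⟨g', -, h' | h'⟩ := cyc_cases a k <;> rw [h'] at h <;> simp at h

theorem mem_zmultiples_of_vX_mem {a g : Γ} {p q : ℕ} (h : vX g ∈ cycSeg a p q) :
    g ∈ AddSubgroup.zmultiples a := by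
  obtain ⟨k, -, -, h⟩ := h
  obtain ⟨g', hg', h' | h'⟩ := cyc_cases a k <;> rw [h'] at h <;> simp at h
  exact h ▸ hg'

theorem mem_zmultiples_of_vL_mem {a g : Γ} {p q : ℕ} (h : vL g ∈ cycSeg a p q) :
    g ∈ AddSubgroup.zmultiples a := by
  obtain ⟨k, -, -, h⟩ := h
  obtain ⟨g', hg', h' | h'⟩ := cyc_cases a k <;> rw [h'] at h <;> simp at h
  exact h ▸ hg'

theorem two_le_addOrderOf [Finite Γ] {a : Γ} (ha : a ≠ 0) : 2 ≤ addOrderOf a := by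
  have h1 := addOrderOf_pos a
  have h2 : addOrderOf a ≠ 1 := fun h => ha (AddMonoid.addOrderOf_eq_one_iff.1 h)
  omega

theorem cyc_adj_last [Finite Γ] {a : Γ} {A B : Set Γ} (h0 : (0 : Γ) ∈ A) (ha : a ∈ A) :
    (groupGraph A B).Adj (cyc a 0) (cyc a (2 * addOrderOf a - 1)) := by
  have h := cyc_adj (B := B) h0 ha (2 * addOrderOf a - 1)
  have hp := addOrderOf_pos a
  rw [Nat.sub_add_cancel (by omega), ← zero_add (2 * addOrderOf a), cyc_add_two_mul, zero_add] at h
  exact h.symm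

/-- The case of two parallel translation directions. -/
theorem not_isPlanar_of_eq [Finite Γ] {a : Γ} (ha : a ≠ 0) :
    ¬ (groupGraph {0, a} {0, a}).IsPlanar := by
  have hr := two_le_addOrderOf ha
  have h0 : (0 : Γ) ∈ ({0, a} : Set Γ) := by simp
  have haa : a ∈ ({0, a} : Set Γ) := by simp
  have c0 : cyc a 0 = vX 0 := by simpa using cyc_even a 0
  have c1 : cyc a 1 = vL a := by simpa using cyc_odd a 0
  have c2 : cyc a 2 = vX a := by simpa using cyc_even a 1
  have hadj := fun k => cyc_adj (B := {0, a}) h0 haa k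
  -- The parts of K₃,₃ are L_a, R_a, {L_{2a}, …, L_0} and X_0, Z_a, X_a. The third set is the cycle
  -- minus its first three vertices; its end L_0 is adjacent to both X_0 and Z_a.
  refine SimpleGraph.not_isPlanar_of_completeBipartite_three
    (B := ![cycSeg a 1 2, {vR a}, cycSeg a 3 (2 * addOrderOf a), cycSeg a 0 1, {vZ a},
      cycSeg a 2 3]) (c := ![cyc a 1, vR a, cyc a 3, cyc a 0, vZ a, cyc a 2])
    ⟨?_, ?_, ?_, ?_⟩
  · intro i
    fin_cases i
    · exact cyc_mem_cycSeg le_rfl (by omega)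
    · exact Set.mem_singleton _
    · exact cyc_mem_cycSeg le_rfl (by omega)
    · exact cyc_mem_cycSeg le_rfl (by omega)
    · exact Set.mem_singleton _
    · exact cyc_mem_cycSeg le_rfl (by omega)
  · intro i j v hi hj
    by_contra hij
    fin_cases i <;> fin_cases j <;> first
      | exact hij rfl
      | exact cycSeg_disjoint (by omega) (by omega) hi hj
      | exact cycSeg_disjoint (by omega) (by omega) hj hi
      | (obtain rfl := Set.mem_singleton_iff.1 hi
         first | exact vR_not_mem_cycSeg hj | exact vZ_not_mem_cycSeg hj | simp at hj)
      | (obtain rfl := Set.mem_singleton_iff.1 hj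
         first | exact vR_not_mem_cycSeg hi | exact vZ_not_mem_cycSeg hi)
  · intro i v hi
    fin_cases i <;> first
      | exact cycSeg_reach h0 haa le_rfl hi
      | (obtain rfl := Set.mem_singleton_iff.1 hi; exact .refl)
  · intro i j hij
    fin_cases i <;> fin_cases j <;> first | exact absurd hij (by decide) | skip
    · exact ⟨_, cyc_mem_cycSeg (k := 1) le_rfl (by omega), _,
        cyc_mem_cycSeg (k := 0) le_rfl (by omega), (hadj 0).symm⟩
    · refine ⟨_, cyc_mem_cycSeg (k := 1) le_rfl (by omega), vZ a, rfl, ?_⟩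
      rw [c1]
      change a - a ∈ _
      simp
    · exact ⟨_, cyc_mem_cycSeg (k := 1) le_rfl (by omega), _,
        cyc_mem_cycSeg (k := 2) le_rfl (by omega), hadj 1⟩
    · refine ⟨vR a, rfl, _, cyc_mem_cycSeg (k := 0) le_rfl (by omega), ?_⟩
      rw [c0]
      change a - 0 ∈ _
      simp
    · refine ⟨vR a, rfl, vZ a, rfl, ?_⟩
      change a - a ∈ _
      simp
    · refine ⟨vR a, rfl, _, cyc_mem_cycSeg (k := 2) le_rfl (by omega), ?_⟩
      rw [c2]
      change a - a ∈ _
      simp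
    · exact ⟨_, cyc_mem_cycSeg (k := 2 * addOrderOf a - 1) (by omega) (by omega), _,
        cyc_mem_cycSeg (k := 0) le_rfl (by omega), (cyc_adj_last h0 haa).symm⟩
    · refine ⟨_, cyc_mem_cycSeg (k := 2 * addOrderOf a - 1) (by omega) (by omega), vZ a, rfl, ?_⟩
      rw [show 2 * addOrderOf a - 1 = 2 * (addOrderOf a - 1) + 1 by omega, cyc_odd,
        Nat.sub_add_cancel (by omega), addOrderOf_nsmul_eq_zero]
      change a - 0 ∈ _
      simp
    · exact ⟨_, cyc_mem_cycSeg (k := 3) (by omega) (by omega), _,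
        cyc_mem_cycSeg (k := 2) le_rfl (by omega), (hadj 2).symm⟩

/-- The case of `b` a multiple of `a`, other than `a` and `-a`. -/
theorem not_isPlanar_of_nsmul [Finite Γ] {a : Γ} {t : ℕ} (ht : 2 ≤ t)
    (htr : t + 2 ≤ addOrderOf a) : ¬ (groupGraph {0, a} {0, t • a}).IsPlanar := by
  set b := t • a with hb
  have h0 : (0 : Γ) ∈ ({0, a} : Set Γ) := by simp
  have haa : a ∈ ({0, a} : Set Γ) := by simp
  have c0 : cyc a 0 = vX 0 := by simpa using cyc_even a 0
  have c1 : cyc a 1 = vL a := by simpa using cyc_odd a 0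
  have c2 : cyc a 2 = vX a := by simpa using cyc_even a 1
  have ct0 : cyc a (2 * t) = vX b := by rw [cyc_even]
  have ct1 : cyc a (2 * t + 1) = vL (a + b) := by rw [cyc_odd, succ_nsmul']
  have ct2 : cyc a (2 * t + 2) = vX (a + b) := by
    rw [show 2 * t + 2 = 2 * (t + 1) by ring, cyc_even, succ_nsmul']
  have hadj := fun k => cyc_adj (B := {0, b}) h0 haa k
  have hab : a + b ≠ b := by
    intro h
    have ha : a = 0 := by simpa using h
    rw [ha, addOrderOf_zero] at htr
    omega
  -- Cut the cycle into the six segments X_0 | L_a | X_a, …, L_b | X_b | L_{a+b} | X_{a+b}, …, L_0.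
  -- Opposite segments are joined through R_b, Z_{a+b} and R_{a+b}, and a hexagon with its three
  -- long diagonals is K₃,₃. The bounds on `t` make the two long segments nonempty.
  refine SimpleGraph.not_isPlanar_of_completeBipartite_three
    (B := ![cycSeg a 0 1 ∪ {vR b}, cycSeg a 2 (2 * t) ∪ {vR (a + b)},
      cycSeg a (2 * t + 1) (2 * t + 2) ∪ ∅, cycSeg a 1 2 ∪ {vZ (a + b)},
      cycSeg a (2 * t) (2 * t + 1) ∪ ∅, cycSeg a (2 * t + 2) (2 * addOrderOf a) ∪ ∅])
    (c := ![cyc a 0, cyc a 2, cyc a (2 * t + 1), cyc a 1, cyc a (2 * t), cyc a (2 * t + 2)])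
    ⟨?_, ?_, ?_, ?_⟩
  · intro i
    fin_cases i <;> exact .inl (cyc_mem_cycSeg le_rfl (by omega))
  · intro i j v hi hj
    by_contra hij
    fin_cases i <;> fin_cases j <;> first
      | exact hij rfl
      | (rcases hi with hi | hi <;> rcases hj with hj | hj <;> first
          | exact cycSeg_disjoint (by omega) (by omega) hi hj
          | exact cycSeg_disjoint (by omega) (by omega) hj hi
          | exact hi
          | exact hj
          | (obtain rfl := Set.mem_singleton_iff.1 hi
             first
              | exact vR_not_mem_cycSeg hj
              | exact vZ_not_mem_cycSeg hj
              | (simp at hj; done)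
              | exact hab (by simpa using hj))
          | (obtain rfl := Set.mem_singleton_iff.1 hj
             first | exact vR_not_mem_cycSeg hi | exact vZ_not_mem_cycSeg hi))
  · intro i v hi
    fin_cases i <;> rcases hi with hi | hi <;> first
      | exact cycSeg_reach h0 haa Set.subset_union_left hi
      | exact hi.elim
      | obtain rfl := Set.mem_singleton_iff.1 hi
    · refine .single ⟨?_, .inr rfl⟩
      rw [show (![cyc a 0, cyc a 2, cyc a (2 * t + 1), cyc a 1, cyc a (2 * t),
        cyc a (2 * t + 2)] ⟨0, by omega⟩ : (Γ ⊕ Γ) ⊕ (Γ ⊕ Γ)) = cyc a 0 from rfl, c0]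
      change b - 0 ∈ _
      simp
    · refine .single ⟨?_, .inr rfl⟩
      rw [show (![cyc a 0, cyc a 2, cyc a (2 * t + 1), cyc a 1, cyc a (2 * t),
        cyc a (2 * t + 2)] ⟨1, by omega⟩ : (Γ ⊕ Γ) ⊕ (Γ ⊕ Γ)) = cyc a 2 from rfl, c2]
      change a + b - a ∈ _
      simp
    · refine .single ⟨?_, .inr rfl⟩
      rw [show (![cyc a 0, cyc a 2, cyc a (2 * t + 1), cyc a 1, cyc a (2 * t),
        cyc a (2 * t + 2)] ⟨3, by omega⟩ : (Γ ⊕ Γ) ⊕ (Γ ⊕ Γ)) = cyc a 1 from rfl, c1]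
      change a + b - a ∈ _
      simp
  · have hmem : ∀ {p q k : ℕ} {S : Set ((Γ ⊕ Γ) ⊕ (Γ ⊕ Γ))}, p ≤ k → k < q →
        cyc a k ∈ cycSeg a p q ∪ S := fun h1 h2 => .inl (cyc_mem_cycSeg h1 h2)
    intro i j hij
    fin_cases i <;> fin_cases j <;> first | exact absurd hij (by decide) | skip
    · exact ⟨_, hmem (k := 0) le_rfl (by omega), _, hmem (k := 1) le_rfl (by omega), hadj 0⟩
    · refine ⟨vR b, .inr rfl, _, hmem (k := 2 * t) le_rfl (by omega), ?_⟩
      rw [ct0]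
      change b - b ∈ _
      simp
    · exact ⟨_, hmem (k := 0) le_rfl (by omega), _,
        hmem (k := 2 * addOrderOf a - 1) (by omega) (by omega), cyc_adj_last h0 haa⟩
    · exact ⟨_, hmem (k := 2) le_rfl (by omega), _, hmem (k := 1) le_rfl (by omega),
        (hadj 1).symm⟩
    · have h := hadj (2 * t - 1)
      rw [Nat.sub_add_cancel (by omega)] at h
      exact ⟨_, hmem (k := 2 * t - 1) (by omega) (by omega), _,
        hmem (k := 2 * t) le_rfl (by omega), h⟩
    · refine ⟨vR (a + b), .inr rfl, _, hmem (k := 2 * t + 2) le_rfl (by omega), ?_⟩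
      rw [ct2]
      change a + b - (a + b) ∈ _
      simp
    · refine ⟨_, hmem (k := 2 * t + 1) le_rfl (by omega), vZ (a + b), .inr rfl, ?_⟩
      rw [ct1]
      change a + b - (a + b) ∈ _
      simp
    · exact ⟨_, hmem (k := 2 * t + 1) le_rfl (by omega), _, hmem (k := 2 * t) le_rfl (by omega),
        (hadj (2 * t)).symm⟩
    · exact ⟨_, hmem (k := 2 * t + 1) le_rfl (by omega), _,
        hmem (k := 2 * t + 2) le_rfl (by omega), hadj (2 * t + 1)⟩

/-- Follow the walk R_g, Z_{g+a}, R_{g+a}, Z_{g+2a}, …. -/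
theorem reach_vR_coset {a g h : Γ} [Finite Γ] {A B : Set Γ} (hA : a ∈ A) (h0 : 0 ∈ A)
    {S : Set ((Γ ⊕ Γ) ⊕ (Γ ⊕ Γ))}
    (hS : ∀ h ∈ AddSubgroup.zmultiples a, vR (g + h) ∈ S ∧ vZ (g + h) ∈ S)
    (hh : h ∈ AddSubgroup.zmultiples a) :
    Relation.ReflTransGen (fun u w => (groupGraph A B).Adj u w ∧ w ∈ S) (vR g) (vR (g + h)) := by
  obtain ⟨n, -, rfl⟩ := exists_nsmul_of_mem_zmultiples hh
  clear hh
  induction n with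
  | zero => rw [zero_nsmul, add_zero]
  | succ n ih =>
    have hn := hS _ (AddSubgroup.nsmul_mem_zmultiples a (n + 1))
    refine (ih.tail (b := vR (g + n • a)) (c := vZ (g + (n + 1) • a)) ⟨?_, hn.2⟩).tail ⟨?_, hn.1⟩
    · change g + (n + 1) • a - (g + n • a) ∈ A
      rwa [succ_nsmul, ← add_assoc, add_sub_cancel_left]
    · change g + (n + 1) • a - (g + (n + 1) • a) ∈ A
      rwa [sub_self]

theorem reach_vX_coset {a g h : Γ} [Finite Γ] {A B : Set Γ} (hA : a ∈ A) (h0 : 0 ∈ A)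
    {S : Set ((Γ ⊕ Γ) ⊕ (Γ ⊕ Γ))}
    (hS : ∀ h ∈ AddSubgroup.zmultiples a, vX (g + h) ∈ S ∧ vL (g + h) ∈ S)
    (hh : h ∈ AddSubgroup.zmultiples a) :
    Relation.ReflTransGen (fun u w => (groupGraph A B).Adj u w ∧ w ∈ S) (vX g) (vX (g + h)) := by
  obtain ⟨n, -, rfl⟩ := exists_nsmul_of_mem_zmultiples hh
  clear hh
  induction n with
  | zero => rw [zero_nsmul, add_zero]
  | succ n ih =>
    have hn := hS _ (AddSubgroup.nsmul_mem_zmultiples a (n + 1))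
    refine (ih.tail (b := vX (g + n • a)) (c := vL (g + (n + 1) • a)) ⟨?_, hn.2⟩).tail ⟨?_, hn.1⟩
    · change g + (n + 1) • a - (g + n • a) ∈ A
      rwa [succ_nsmul, ← add_assoc, add_sub_cancel_left]
    · change g + (n + 1) • a - (g + (n + 1) • a) ∈ A
      rwa [sub_self]

/-- The union of the cosets `b + H, 2 b + H, …` before the first return to `H`, where `H` is
generated by `a`. -/
def OffRow (a b g : Γ) : Prop :=
  ∃ j : ℕ, (∀ i ≤ j, (i + 1) • b ∉ AddSubgroup.zmultiples a) ∧
    g - (j + 1) • b ∈ AddSubgroup.zmultiples a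

theorem OffRow.not_mem {a b g : Γ} (h : OffRow a b g) : g ∉ AddSubgroup.zmultiples a := by
  obtain ⟨j, h1, h2⟩ := h
  intro hg
  refine h1 j le_rfl ?_
  have := AddSubgroup.sub_mem _ hg h2
  rwa [sub_sub_cancel] at this

theorem OffRow.add {a b g h : Γ} (hg : OffRow a b g) (hh : h ∈ AddSubgroup.zmultiples a) :
    OffRow a b (g + h) := by
  obtain ⟨j, h1, h2⟩ := hg
  refine ⟨j, h1, ?_⟩
  rw [add_sub_right_comm]
  exact AddSubgroup.add_mem _ h2 hh

theorem offRow_self {a b : Γ} (hb : b ∉ AddSubgroup.zmultiples a) : OffRow a b b :=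
  ⟨0, fun i hi => by simpa [Nat.le_zero.1 hi] using hb, by simp⟩

/-- If (d + 1) b is the first positive multiple of b in ⟨a⟩, then -b lies in the coset of d b, the
last one before the return. -/
theorem offRow_neg [Finite Γ] {a b : Γ} (hb : b ∉ AddSubgroup.zmultiples a) :
    OffRow a b (-b) := by
  classical
  have hex : ∃ j : ℕ, (j + 1) • b ∈ AddSubgroup.zmultiples a := by
    refine ⟨addOrderOf b - 1, ?_⟩
    rw [Nat.sub_add_cancel (addOrderOf_pos b), addOrderOf_nsmul_eq_zero]
    exact AddSubgroup.zero_mem _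
  have hd := Nat.find_spec hex
  have hmin := fun i => Nat.find_min hex (m := i)
  set d := Nat.find hex
  have hd0 : d ≠ 0 := fun h => hb (by rw [h] at hd; simpa using hd)
  refine ⟨d - 1, fun i hi => hmin i (by omega), ?_⟩
  rw [Nat.sub_add_cancel (by omega)]
  have := AddSubgroup.neg_mem _ hd
  rw [succ_nsmul] at this
  convert this using 1
  abel

/-- The case of `b` not a multiple of `a`. -/
theorem not_isPlanar_of_not_mem [Finite Γ] {a b : Γ} (ha : a ≠ 0)
    (hb : b ∉ AddSubgroup.zmultiples a) : ¬ (groupGraph {0, a} {0, b}).IsPlanar := by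
  have hr := two_le_addOrderOf ha
  have h0 : (0 : Γ) ∈ ({0, a} : Set Γ) := by simp
  have haa : a ∈ ({0, a} : Set Γ) := by simp
  have haH : a ∈ AddSubgroup.zmultiples a := AddSubgroup.mem_zmultiples a
  have h0H : (0 : Γ) ∈ AddSubgroup.zmultiples a := AddSubgroup.zero_mem _
  have c0 : cyc a 0 = vX 0 := by simpa using cyc_even a 0
  have c1 : cyc a 1 = vL a := by simpa using cyc_odd a 0
  have c2 : cyc a 2 = vX a := by simpa using cyc_even a 1
  have hadj := fun k => cyc_adj (B := {0, b}) h0 haa k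
  -- `P` is the Z-R cycle over ⟨a⟩, and `Q` consists of all four kinds of vertices over the other
  -- cosets met by the multiples of b.
  let P : Set ((Γ ⊕ Γ) ⊕ (Γ ⊕ Γ)) := {v | ∃ g ∈ AddSubgroup.zmultiples a, v = vR g ∨ v = vZ g}
  let Q : Set ((Γ ⊕ Γ) ⊕ (Γ ⊕ Γ)) :=
    {v | ∃ g, OffRow a b g ∧ (v = vX g ∨ v = vL g ∨ v = vR g ∨ v = vZ g)}
  have hbQ := offRow_self hb
  have habQ : OffRow a b (a + b) := by rw [add_comm]; exact hbQ.add haH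
  have hPseg : ∀ {v p q}, v ∈ cycSeg a p q → v ∈ P → False := by
    rintro v p q hv ⟨g, -, rfl | rfl⟩
    · exact vR_not_mem_cycSeg hv
    · exact vZ_not_mem_cycSeg hv
  have hQseg : ∀ {v p q}, v ∈ cycSeg a p q → v ∈ Q → False := by
    rintro v p q hv ⟨g, hg, rfl | rfl | rfl | rfl⟩
    · exact hg.not_mem (mem_zmultiples_of_vX_mem hv)
    · exact hg.not_mem (mem_zmultiples_of_vL_mem hv)
    · exact vR_not_mem_cycSeg hv
    · exact vZ_not_mem_cycSeg hv
  have hPQ : ∀ {v}, v ∈ P → v ∈ Q → False := by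
    rintro v ⟨g, hg, rfl | rfl⟩ ⟨g', hg', h⟩ <;> simp at h <;> exact hg'.not_mem (h ▸ hg)
  have hZR : ∀ {g : Γ} {S : Set ((Γ ⊕ Γ) ⊕ (Γ ⊕ Γ))} {v}, vZ g ∈ S →
      Relation.ReflTransGen (fun u w => (groupGraph {0, a} {0, b}).Adj u w ∧ w ∈ S) v (vR g) →
      Relation.ReflTransGen (fun u w => (groupGraph {0, a} {0, b}).Adj u w ∧ w ∈ S) v (vZ g) := by
    intro g S v hg h
    refine h.tail ⟨?_, hg⟩
    change g - g ∈ _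
    simp
  have hPcon : ∀ v ∈ P, Relation.ReflTransGen
      (fun u w => (groupGraph {0, a} {0, b}).Adj u w ∧ w ∈ P) (vR 0) v := by
    have hR : ∀ g ∈ AddSubgroup.zmultiples a, Relation.ReflTransGen
        (fun u w => (groupGraph {0, a} {0, b}).Adj u w ∧ w ∈ P) (vR 0) (vR g) := by
      intro g hg
      have := reach_vR_coset (g := 0) (B := {0, b}) haa h0 (S := P) (fun h hh => by
        rw [zero_add]; exact ⟨⟨h, hh, .inl rfl⟩, ⟨h, hh, .inr rfl⟩⟩) hg
      rwa [zero_add] at this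
    rintro v ⟨g, hg, rfl | rfl⟩
    · exact hR g hg
    · exact hZR ⟨g, hg, .inr rfl⟩ (hR g hg)
  have hQR : ∀ {g}, OffRow a b g → vR g ∈ Q := fun {g} h => ⟨g, h, by simp⟩
  have hQZ : ∀ {g}, OffRow a b g → vZ g ∈ Q := fun {g} h => ⟨g, h, by simp⟩
  have hQX : ∀ {g}, OffRow a b g → vX g ∈ Q := fun {g} h => ⟨g, h, by simp⟩
  have hQL : ∀ {g}, OffRow a b g → vL g ∈ Q := fun {g} h => ⟨g, h, by simp⟩
  have hQcon : ∀ v ∈ Q, Relation.ReflTransGen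
      (fun u w => (groupGraph {0, a} {0, b}).Adj u w ∧ w ∈ Q) (vR b) v := by
    -- Within `Q` one climbs from coset to coset by R_g, X_g, R_{g+b}. It then remains to spread out
    -- inside each coset along its cycles.
    have hcol : ∀ j : ℕ, (∀ i ≤ j, (i + 1) • b ∉ AddSubgroup.zmultiples a) →
        Relation.ReflTransGen (fun u w => (groupGraph {0, a} {0, b}).Adj u w ∧ w ∈ Q) (vR b)
          (vR ((j + 1) • b)) ∧
        Relation.ReflTransGen (fun u w => (groupGraph {0, a} {0, b}).Adj u w ∧ w ∈ Q) (vR b)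
          (vX ((j + 1) • b)) := by
      intro j hj
      have hRX : ∀ g, OffRow a b g →
          Relation.ReflTransGen (fun u w => (groupGraph {0, a} {0, b}).Adj u w ∧ w ∈ Q) (vR b)
            (vR g) →
          Relation.ReflTransGen (fun u w => (groupGraph {0, a} {0, b}).Adj u w ∧ w ∈ Q) (vR b)
            (vX g) := by
        intro g hg h
        refine h.tail ⟨?_, hQX hg⟩
        change g - g ∈ _
        simp
      have hoff : OffRow a b ((j + 1) • b) := ⟨j, hj, by rw [sub_self]; exact h0H⟩
      suffices h : Relation.ReflTransGen (fun u w => (groupGraph {0, a} {0, b}).Adj u w ∧ w ∈ Q)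
          (vR b) (vR ((j + 1) • b)) from ⟨h, hRX _ hoff h⟩
      induction j with
      | zero => rw [zero_add, one_nsmul]
      | succ j ih =>
        have hj' : ∀ i ≤ j, (i + 1) • b ∉ AddSubgroup.zmultiples a := fun i hi => hj i (by omega)
        have hoff' : OffRow a b ((j + 1) • b) := ⟨j, hj', by rw [sub_self]; exact h0H⟩
        refine (hRX _ hoff' (ih hj' hoff')).tail ⟨?_, hQR hoff⟩
        change (j + 1 + 1) • b - (j + 1) • b ∈ _
        rw [succ_nsmul _ (j + 1), add_sub_cancel_left]
        simp
    have hR : ∀ g, OffRow a b g → Relation.ReflTransGen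
        (fun u w => (groupGraph {0, a} {0, b}).Adj u w ∧ w ∈ Q) (vR b) (vR g) ∧
        Relation.ReflTransGen
        (fun u w => (groupGraph {0, a} {0, b}).Adj u w ∧ w ∈ Q) (vR b) (vX g) := by
      rintro g ⟨j, hj, hg⟩
      have hoff : OffRow a b ((j + 1) • b) := ⟨j, hj, by rw [sub_self]; exact h0H⟩
      have h1 := reach_vR_coset (g := (j + 1) • b) (B := {0, b}) haa h0 (S := Q) (fun h hh =>
        ⟨hQR (hoff.add hh), hQZ (hoff.add hh)⟩) hg
      have h2 := reach_vX_coset (g := (j + 1) • b) (B := {0, b}) haa h0 (S := Q) (fun h hh =>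
        ⟨hQX (hoff.add hh), hQL (hoff.add hh)⟩) hg
      rw [add_sub_cancel] at h1 h2
      exact ⟨(hcol j hj).1.trans h1, (hcol j hj).2.trans h2⟩
    rintro v ⟨g, hg, rfl | rfl | rfl | rfl⟩
    · exact (hR g hg).2
    · refine (hR g hg).2.tail ⟨?_, hQL hg⟩
      change g - g ∈ _
      simp
    · exact (hR g hg).1
    · exact hZR (hQZ hg) (hR g hg).1
  -- The X-L cycle over ⟨a⟩ is cut into three pairwise adjacent arcs X_0, L_a and {X_a, …, L_0}.
  -- Each has a neighbour in `P` (terms 0) and in `Q` (term b), and `P` meets `Q` in the edge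
  -- between R_0 and X_{-b}.
  refine SimpleGraph.not_isPlanar_of_completeGraph_five
    (B := ![cycSeg a 0 1, cycSeg a 1 2, cycSeg a 2 (2 * addOrderOf a), P, Q])
    (c := ![cyc a 0, cyc a 1, cyc a 2, vR 0, vR b]) ⟨?_, ?_, ?_, ?_⟩
  · intro i
    fin_cases i
    · exact cyc_mem_cycSeg le_rfl (by omega)
    · exact cyc_mem_cycSeg le_rfl (by omega)
    · exact cyc_mem_cycSeg le_rfl (by omega)
    · exact ⟨0, h0H, .inl rfl⟩
    · exact hQR hbQ
  · intro i j v hi hj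
    by_contra hij
    fin_cases i <;> fin_cases j <;> first
      | exact hij rfl
      | exact cycSeg_disjoint (by omega) (by omega) hi hj
      | exact cycSeg_disjoint (by omega) (by omega) hj hi
      | exact hPseg hi hj
      | exact hPseg hj hi
      | exact hQseg hi hj
      | exact hQseg hj hi
      | exact hPQ hi hj
      | exact hPQ hj hi
  · intro i v hi
    fin_cases i <;> first
      | exact cycSeg_reach h0 haa le_rfl hi
      | exact hPcon v hi
      | exact hQcon v hi
  · intro i j hij
    fin_cases i <;> fin_cases j <;> first | exact absurd hij (by decide) | skip
    · exact ⟨_, cyc_mem_cycSeg (k := 0) le_rfl (by omega), _,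
        cyc_mem_cycSeg (k := 1) le_rfl (by omega), hadj 0⟩
    · exact ⟨_, cyc_mem_cycSeg (k := 0) le_rfl (by omega), _,
        cyc_mem_cycSeg (k := 2 * addOrderOf a - 1) (by omega) (by omega), cyc_adj_last h0 haa⟩
    · refine ⟨_, cyc_mem_cycSeg (k := 0) le_rfl (by omega), vR 0, ⟨0, h0H, .inl rfl⟩, ?_⟩
      rw [c0]
      change (0 : Γ) - 0 ∈ _
      simp
    · refine ⟨_, cyc_mem_cycSeg (k := 0) le_rfl (by omega), vR b, hQR hbQ, ?_⟩
      rw [c0]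
      change b - 0 ∈ _
      simp
    · exact ⟨_, cyc_mem_cycSeg (k := 1) le_rfl (by omega), _,
        cyc_mem_cycSeg (k := 2) le_rfl (by omega), hadj 1⟩
    · refine ⟨_, cyc_mem_cycSeg (k := 1) le_rfl (by omega), vZ a, ⟨a, haH, .inr rfl⟩, ?_⟩
      rw [c1]
      change a - a ∈ _
      simp
    · refine ⟨_, cyc_mem_cycSeg (k := 1) le_rfl (by omega), vZ (a + b), hQZ habQ, ?_⟩
      rw [c1]
      change a + b - a ∈ _
      simp
    · refine ⟨_, cyc_mem_cycSeg (k := 2) le_rfl (by omega), vR a, ⟨a, haH, .inl rfl⟩, ?_⟩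
      rw [c2]
      change a - a ∈ _
      simp
    · refine ⟨_, cyc_mem_cycSeg (k := 2) le_rfl (by omega), vR (a + b), hQR habQ, ?_⟩
      rw [c2]
      change a + b - a ∈ _
      simp
    · refine ⟨vR 0, ⟨0, h0H, .inl rfl⟩, vX (-b), hQX (offRow_neg hb), ?_⟩
      change 0 - -b ∈ _
      simp

/-- In the case b = t a, the value t = r - 1 (with r the order of a) means b = -a. The hypothesis
`hab` turns this into b = a, which is treated separately. -/
theorem not_isPlanar_of_ne_zero [Finite Γ] {a b : Γ} (ha : a ≠ 0) (hb : b ≠ 0)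
    (hab : b = -a → b = a) : ¬ (groupGraph {0, a} {0, b}).IsPlanar := by
  by_cases hba : b = a
  · rw [hba]
    exact not_isPlanar_of_eq ha
  by_cases hH : b ∈ AddSubgroup.zmultiples a
  · obtain ⟨t, ht, rfl⟩ := exists_nsmul_of_mem_zmultiples hH
    have h0 : t ≠ 0 := fun h => hb (by rw [h, zero_nsmul])
    have h1 : t ≠ 1 := fun h => hba (by rw [h, one_nsmul])
    refine not_isPlanar_of_nsmul (by omega) ?_
    by_contra h
    refine hba (hab (eq_neg_of_add_eq_zero_left ?_))
    rw [← succ_nsmul, show t + 1 = addOrderOf a by omega, addOrderOf_nsmul_eq_zero]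
  · exact not_isPlanar_of_not_mem ha hH

/-- With at least two terms in `A` and in `B` the Tanner graph is not planar. -/
theorem groupGraph_not_isPlanar [Finite Γ] {A B : Set Γ} (hA : A.Nontrivial) (hB : B.Nontrivial) :
    ¬ (groupGraph A B).IsPlanar := by
  obtain ⟨a₁, ha₁, a₂, ha₂, ha⟩ := hA
  -- Exchanging the two terms of `B` replaces their difference by its negative.
  have key : ∃ b₁ ∈ B, ∃ b₂ ∈ B, b₁ ≠ b₂ ∧ (b₂ - b₁ = -(a₂ - a₁) → b₂ - b₁ = a₂ - a₁) := by
    obtain ⟨b₁, hb₁, b₂, hb₂, hb⟩ := hB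
    by_cases h : b₂ - b₁ = -(a₂ - a₁)
    · refine ⟨b₂, hb₂, b₁, hb₁, hb.symm, fun _ => ?_⟩
      rw [← neg_sub, h, neg_neg]
    · exact ⟨b₁, hb₁, b₂, hb₂, hb, fun h' => absurd h' h⟩
  obtain ⟨b₁, hb₁, b₂, hb₂, hb, hab⟩ := key
  intro hp
  refine not_isPlanar_of_ne_zero (sub_ne_zero.2 ha.symm) (sub_ne_zero.2 hb.symm) hab ?_
  refine SimpleGraph.IsPlanar.of_hom (SimpleGraph.IsPlanar.of_hom hp
    (groupGraphTranslate A B a₁ b₁) (groupGraphTranslate_injective A B a₁ b₁))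
    (SimpleGraph.Hom.ofLE (groupGraph_mono ?_ ?_)) Function.injective_id
  · rintro g (rfl | rfl)
    · simpa using ha₁
    · simpa using ha₂
  · rintro g (rfl | rfl)
    · simpa using hb₁
    · simpa using hb₂

end TB

/-! ## Planarity of disjoint prisms -/

namespace SimpleGraph

/-- The arcs have an index type of their own, so that a drawing may contain arcs that are not edges
of `G`; different arcs may even have the same two ends. -/
theorem isPlanar_of_drawing {V ι : Type*} {G : SimpleGraph V} (pos : V → ℂ) (ends : ι → Sym2 V)
    (γ : ι → ℝ → ℂ) (hpos : Function.Injective pos) (hγ : ∀ i, Continuous (γ i))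
    (hinj : ∀ i, Set.InjOn (γ i) (Set.Icc 0 1))
    (hends : ∀ i, s(γ i 0, γ i 1) = (ends i).map pos)
    (hcross : ∀ i j, i ≠ j → ∀ s ∈ Set.Icc (0 : ℝ) 1, ∀ t ∈ Set.Icc (0 : ℝ) 1, γ i s = γ j t →
      (s = 0 ∨ s = 1) ∧ (t = 0 ∨ t = 1))
    (hvert : ∀ i, ∀ t ∈ Set.Icc (0 : ℝ) 1, ∀ v, γ i t = pos v → t = 0 ∨ t = 1)
    (hadj : ∀ u v, G.Adj u v → ∃ i, ends i = s(u, v)) : G.IsPlanar := by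
  have hex : ∀ e : G.edgeSet, ∃ i, ends i = (e : Sym2 V) := by
    rintro ⟨e, he⟩
    induction e with
    | h u v => exact hadj u v he
  choose idx hidx using hex
  have hidx_ne : ∀ e f, e ≠ f → idx e ≠ idx f := fun e f h h' =>
    h (Subtype.ext (by rw [← hidx, ← hidx, h']))
  let Φ := Complex.orthonormalBasisOneI.repr
  have hΦ : Function.Injective Φ := Φ.injective
  have hend : ∀ t : unitInterval, (t : ℝ) = 0 ∨ (t : ℝ) = 1 → t = 0 ∨ t = 1 := fun t h =>
    h.imp (fun h => Subtype.ext h) (fun h => Subtype.ext h)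
  refine ⟨fun v => Φ (pos v),
    fun e => ⟨fun t => Φ (γ (idx e) t), Φ.continuous.comp ((hγ _).comp continuous_subtype_val)⟩,
    hΦ.comp hpos, fun e s t h => Subtype.ext (hinj _ s.2 t.2 (hΦ h)), fun e => ?_,
    fun e f hef s t h => ?_, fun e t v h => ?_⟩
  · have := congrArg (Sym2.map Φ) (hends (idx e))
    rw [hidx, Sym2.map_map] at this
    simpa using this
  · have := hcross _ _ (hidx_ne e f hef) s s.2 t t.2 (hΦ h)
    exact ⟨hend s this.1, hend t this.2⟩
  · have h' := hΦ h
    have : γ (idx e) t ∈ s(γ (idx e) 0, γ (idx e) 1) := by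
      rcases hvert _ t t.2 v h' with ht | ht <;> rw [ht] <;> simp
    rw [hends, hidx, h', Sym2.mem_map] at this
    obtain ⟨w, hw, hw'⟩ := this
    exact hpos hw' ▸ hw

end SimpleGraph

/-! ### Drawing on concentric circles and rays -/

namespace Cylinder

noncomputable def polar (n : ℕ) (r x : ℝ) : ℂ :=
  r * Complex.exp (x / n * (2 * Real.pi * Complex.I))

theorem continuous_polar (n : ℕ) {f g : ℝ → ℝ} (hf : Continuous f) (hg : Continuous g) :
    Continuous fun t => polar n (f t) (g t) := by
  unfold polar
  fun_prop

theorem polar_eq {n : ℕ} (hn : n ≠ 0) {r r' x x' : ℝ} (hr : 0 < r) (hr' : 0 < r')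
    (h : polar n r x = polar n r' x') : r = r' ∧ ∃ k : ℤ, x = x' + k * n := by
  unfold polar at h
  have hnorm : ∀ r x : ℝ, 0 < r →
      ‖(r : ℂ) * Complex.exp (x / n * (2 * Real.pi * Complex.I))‖ = r := by
    intro r x hr
    rw [norm_mul, show (x / n * (2 * Real.pi * Complex.I) : ℂ)
      = ((x / n * (2 * Real.pi) : ℝ) : ℂ) * Complex.I by push_cast; ring,
      Complex.norm_exp_ofReal_mul_I, mul_one, Complex.norm_real, Real.norm_of_nonneg hr.le]
  have hrr : r = r' := by rw [← hnorm r x hr, h, hnorm r' x' hr']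
  refine ⟨hrr, ?_⟩
  rw [hrr] at h
  have h2 := mul_left_cancel₀ (Complex.ofReal_ne_zero.2 hr'.ne') h
  obtain ⟨k, hk⟩ := Complex.exp_eq_exp_iff_exists_int.1 h2
  refine ⟨k, ?_⟩
  rw [← add_mul] at hk
  have h3 := mul_right_cancel₀ Complex.two_pi_I_ne_zero hk
  have hn' : (n : ℂ) ≠ 0 := Nat.cast_ne_zero.2 hn
  have h4 : (x : ℂ) = x' + k * n := by
    field_simp at h3
    linear_combination h3
  exact_mod_cast h4

theorem polar_add_mul {n : ℕ} (hn : n ≠ 0) (r x : ℝ) (k : ℤ) :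
    polar n r (x + k * n) = polar n r x := by
  unfold polar
  congr 1
  rw [Complex.exp_eq_exp_iff_exists_int]
  refine ⟨k, ?_⟩
  have hn' : (n : ℂ) ≠ 0 := Nat.cast_ne_zero.2 hn
  push_cast
  field_simp

theorem eq_zero_or_one {s : ℝ} (hs : s ∈ Set.Icc (0 : ℝ) 1) {m : ℤ} (h : s = m) :
    s = 0 ∨ s = 1 := by
  have h0 : (0 : ℤ) ≤ m := by exact_mod_cast h ▸ hs.1
  have h1 : m ≤ (1 : ℤ) := by exact_mod_cast h ▸ hs.2
  rcases (by omega : m = 0 ∨ m = 1) with rfl | rfl <;> simp [h]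

/-- Parameters of a common point of two arcs on one ring, or on one ray, differ by an integer.
Either that integer vanishes, which will force the arcs to coincide, or the point is an end of both.
-/
theorem eq_zero_or_ends {s t : ℝ} (hs : s ∈ Set.Icc (0 : ℝ) 1) (ht : t ∈ Set.Icc (0 : ℝ) 1)
    {m : ℤ} (h : s = t + m) : m = 0 ∨ (s = 0 ∨ s = 1) ∧ (t = 0 ∨ t = 1) := by
  have h0 : (-1 : ℤ) ≤ m := by
    have : (-1 : ℝ) ≤ m := by linarith [hs.1, ht.2]
    exact_mod_cast this
  have h1 : m ≤ (1 : ℤ) := by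
    have : (m : ℝ) ≤ 1 := by linarith [hs.2, ht.1]
    exact_mod_cast this
  rcases (by omega : m = -1 ∨ m = 0 ∨ m = 1) with rfl | rfl | rfl
  · push_cast at h
    exact .inr ⟨.inl (by linarith [hs.1, ht.2]), .inr (by linarith [hs.1, ht.2])⟩
  · exact .inl rfl
  · push_cast at h
    exact .inr ⟨.inr (by linarith [hs.2, ht.1]), .inl (by linarith [hs.2, ht.1])⟩

variable {n : ℕ}

theorem eq_of_val_eq [NeZero n] {p q : ZMod n} {k : ℤ} (h : (p.val : ℝ) = q.val + k * n) :
    p = q := by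
  have h' : (p.val : ℤ) = q.val + k * n := by exact_mod_cast h
  have := congrArg (Int.cast : ℤ → ZMod n) h'
  simpa using this

/-- The arcs are indexed by their lower end and by whether they are radial. -/
def ends (i : (ℕ × ZMod n) × Bool) : Sym2 (ℕ × ZMod n) :=
  s(i.1, if i.2 then (i.1.1 + 1, i.1.2) else (i.1.1, i.1.2 + 1))

noncomputable def curve (i : (ℕ × ZMod n) × Bool) (t : ℝ) : ℂ :=
  if i.2 then polar n (i.1.1 + 1 + t) i.1.2.val else polar n (i.1.1 + 1) (i.1.2.val + t)

/-- Radii start at 1, which keeps ring 0 away from the origin. -/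
noncomputable def pos (v : ℕ × ZMod n) : ℂ := polar n (v.1 + 1) v.2.val

theorem pos_injective [NeZero n] : Function.Injective (pos (n := n)) := by
  intro u v h
  obtain ⟨h1, k, h2⟩ := polar_eq (NeZero.ne n) (by positivity) (by positivity) h
  exact Prod.ext (by exact_mod_cast add_right_cancel h1) (eq_of_val_eq h2)

/-- A graph whose edges join neighbours on concentric rings, or on a common ray, is planar. -/
theorem isPlanar (hn : 2 ≤ n) (G : SimpleGraph (ℕ × ZMod n))
    (hG : ∀ u v, G.Adj u v → ∃ i, ends i = s(u, v)) : G.IsPlanar := by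
  have hn0 : n ≠ 0 := by omega
  have : NeZero n := ⟨hn0⟩
  refine SimpleGraph.isPlanar_of_drawing pos ends curve pos_injective ?_ ?_ ?_ ?_ ?_ hG
  · rintro ⟨⟨ρ, p⟩, _ | _⟩
    · exact continuous_polar n (by fun_prop) (by fun_prop)
    · exact continuous_polar n (by fun_prop) (by fun_prop)
  · rintro ⟨⟨ρ, p⟩, _ | _⟩ s hs t ht h
    · simp only [curve, Bool.false_eq_true, if_false] at h
      obtain ⟨-, k, hk⟩ := polar_eq hn0 (by positivity) (by positivity) h
      have hk' : s = t + ((k * n : ℤ) : ℝ) := by push_cast; linarith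
      have hb1 : k * n ≤ 1 := by
        have : ((k * n : ℤ) : ℝ) ≤ 1 := by linarith [hs.2, ht.1]
        exact_mod_cast this
      have hb2 : -1 ≤ k * n := by
        have : (-1 : ℝ) ≤ ((k * n : ℤ) : ℝ) := by linarith [hs.1, ht.2]
        exact_mod_cast this
      -- An arc covers one n-th of its ring, so for n ≥ 2 it does not close up.
      have hk0 : k = 0 := by
        have hn' : (2 : ℤ) ≤ n := by exact_mod_cast hn
        rcases lt_trichotomy k 0 with h | h | h
        · nlinarith
        · exact h
        · nlinarith
      rw [hk0] at hk'
      simpa using hk'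
    · simp only [curve, if_true] at h
      obtain ⟨h, -⟩ := polar_eq hn0 (by linarith [hs.1, (Nat.cast_nonneg ρ : (0 : ℝ) ≤ ρ)])
        (by linarith [ht.1, (Nat.cast_nonneg ρ : (0 : ℝ) ≤ ρ)]) h
      linarith
  · rintro ⟨⟨ρ, p⟩, _ | _⟩
    · simp only [curve, ends, Bool.false_eq_true, if_false, Sym2.map_mk, pos, add_zero]
      refine congrArg (fun z => s(polar n (ρ + 1) p.val, z)) ?_
      have : ((p.val + 1 : ℕ) : ZMod n) = (((p + 1).val : ℕ) : ZMod n) := by simp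
      rw [ZMod.natCast_eq_natCast_iff, Nat.modEq_iff_dvd] at this
      obtain ⟨k, hk⟩ := this
      have hk' : ((p + 1).val : ℝ) = (p.val + 1 : ℝ) + k * n := by
        have : ((p + 1).val : ℤ) = (p.val + 1) + k * n := by push_cast at hk; linarith
        exact_mod_cast this
      rw [hk', polar_add_mul hn0]
    · simp [curve, ends, pos]
  · rintro ⟨⟨ρ, p⟩, _ | _⟩ ⟨⟨ρ', p'⟩, _ | _⟩ hij s hs t ht h <;>
      simp only [curve, if_true, Bool.false_eq_true, if_false] at h <;>
      have hρ := (Nat.cast_nonneg ρ : (0 : ℝ) ≤ ρ) <;>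
      have hρ' := (Nat.cast_nonneg ρ' : (0 : ℝ) ≤ ρ') <;>
      obtain ⟨h1, k, h2⟩ := polar_eq hn0 (by linarith [hs.1]) (by linarith [ht.1]) h
    · rcases eq_zero_or_ends hs ht (m := p'.val - p.val + k * n) (by push_cast; linarith)
        with hm | hm
      · refine absurd ?_ hij
        have hp : p = p' := eq_of_val_eq (k := k) (by
          have : (p.val : ℤ) = p'.val + k * n := by linarith
          exact_mod_cast this)
        have hρρ : ρ = ρ' := by exact_mod_cast add_right_cancel h1
        rw [hp, hρρ]
      · exact hm
    · exact ⟨eq_zero_or_one hs (m := p'.val - p.val + k * n) (by push_cast; linarith),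
        eq_zero_or_one ht (m := ρ - ρ') (by push_cast; linarith)⟩
    · exact ⟨eq_zero_or_one hs (m := ρ' - ρ) (by push_cast; linarith),
        eq_zero_or_one ht (m := p.val - p'.val - k * n) (by push_cast; linarith)⟩
    · rcases eq_zero_or_ends hs ht (m := ρ' - ρ) (by push_cast; linarith) with hm | hm
      · refine absurd ?_ hij
        have hρρ : ρ = ρ' := by omega
        rw [eq_of_val_eq h2, hρρ]
      · exact hm
  · rintro ⟨⟨ρ, p⟩, _ | _⟩ s hs ⟨ρ', p'⟩ h <;>
      simp only [curve, pos, if_true, Bool.false_eq_true, if_false] at h <;>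
      have hρ := (Nat.cast_nonneg ρ : (0 : ℝ) ≤ ρ) <;>
      obtain ⟨h1, k, h2⟩ := polar_eq hn0 (by linarith [hs.1]) (by positivity) h
    · exact eq_zero_or_one hs (m := p'.val - p.val + k * n) (by push_cast; linarith)
    · exact eq_zero_or_one hs (m := ρ' - ρ) (by push_cast; linarith)

end Cylinder

/-! ### Planarity of the graph of one label -/

namespace TB

variable {Γ : Type*} [AddCommGroup Γ]

/-- Every element of `Γ` is determined by the number of its coset modulo `a` and by its position in
the coset. -/
theorem exists_coset_coordinates [Finite Γ] (a : Γ) : ∃ c κ : Γ → ℕ,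
    (∀ g, c (g + a) = c g) ∧ (∀ g, κ (g + a) ≡ κ g + 1 [MOD addOrderOf a]) ∧
    ∀ g h, c g = c h → κ g ≡ κ h [MOD addOrderOf a] → g = h := by
  let H := AddSubgroup.zmultiples a
  obtain ⟨enc, henc⟩ := exists_injective_nat (Γ ⧸ H)
  have hex : ∀ g : Γ, ∃ k : ℕ, k • a = g - (QuotientAddGroup.mk g : Γ ⧸ H).out := by
    intro g
    have : g - (QuotientAddGroup.mk g : Γ ⧸ H).out ∈ H := by
      rw [sub_eq_neg_add, ← QuotientAddGroup.eq, QuotientAddGroup.out_eq']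
    obtain ⟨k, -, hk⟩ := exists_nsmul_of_mem_zmultiples this
    exact ⟨k, hk⟩
  choose κ hκ using hex
  have hmk : ∀ g, (QuotientAddGroup.mk (g + a) : Γ ⧸ H) = QuotientAddGroup.mk g := fun g =>
    QuotientAddGroup.mk_add_of_mem g (AddSubgroup.mem_zmultiples a)
  refine ⟨fun g => enc (QuotientAddGroup.mk g), κ, fun g => ?_, fun g => ?_, fun g h hc hk => ?_⟩
  · simp only [hmk]
  · rw [← nsmul_eq_nsmul_iff_modEq, hκ, hmk, succ_nsmul, hκ]
    abel
  · rw [← nsmul_eq_nsmul_iff_modEq, hκ, hκ, henc hc] at hk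
    exact sub_left_inj.1 hk

/-- With r the order of a, each coset of ⟨a⟩ carries a prism over a 2r-cycle: X and L alternate on
one ring, Z and R on the next, with spokes between X_i and R_i and between L_i and Z_i. -/
theorem groupGraph_pair_zero_isPlanar [Finite Γ] {a : Γ} (ha : a ≠ 0) :
    (groupGraph {0, a} {0}).IsPlanar := by
  have hr := two_le_addOrderOf ha
  obtain ⟨c, κ, hc, hκ, hinj⟩ := exists_coset_coordinates a
  set r := addOrderOf a
  have hstep : ∀ g, (2 * κ (g + a) : ZMod (2 * r)) = 2 * κ g + 2 := by
    intro g
    have := (ZMod.natCast_eq_natCast_iff _ _ _).2 ((hκ g).mul_left' 2)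
    push_cast at this
    rw [this]
    ring
  have heven : ∀ g h, (2 * κ g : ZMod (2 * r)) = 2 * κ h → κ g ≡ κ h [MOD r] := by
    intro g h hgh
    have : ((2 * κ g : ℕ) : ZMod (2 * r)) = (2 * κ h : ℕ) := by exact_mod_cast hgh
    exact Nat.ModEq.mul_left_cancel' two_ne_zero ((ZMod.natCast_eq_natCast_iff _ _ _).1 this)
  have hodd : ∀ g h, (2 * κ g : ZMod (2 * r)) ≠ 2 * κ h - 1 := by
    intro g h hgh
    have : ((2 * κ g + 1 : ℕ) : ZMod (2 * r)) = (2 * κ h : ℕ) := by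
      push_cast
      rw [hgh]
      ring
    have := ((ZMod.natCast_eq_natCast_iff _ _ _).1 this).of_mul_right r
    rw [Nat.ModEq] at this
    omega
  -- Coset number c takes the rings 2c and 2c + 1. X and R sit at even angles and L and Z at odd
  -- ones, so the two neighbours of X_i on its ring are L_i and L_{i+a}.
  let f : (Γ ⊕ Γ) ⊕ (Γ ⊕ Γ) → ℕ × ZMod (2 * r)
    | .inl (.inl i) => (2 * c i, 2 * κ i)
    | .inl (.inr i) => (2 * c i + 1, 2 * κ i - 1)
    | .inr (.inl i) => (2 * c i, 2 * κ i - 1)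
    | .inr (.inr i) => (2 * c i + 1, 2 * κ i)
  have hf : Function.Injective f := by
    rintro ((u | u) | (u | u)) ((v | v) | (v | v)) h <;>
      obtain ⟨h1, h2⟩ := Prod.ext_iff.1 h <;> simp only [f] at h1 h2 <;> first
      | omega
      | exact absurd h2 (hodd _ _)
      | exact absurd h2.symm (hodd _ _)
      | rw [hinj u v (by omega) (heven _ _ h2)]
      | rw [hinj u v (by omega) (heven _ _ (sub_left_inj.1 h2))]
  have hadj : ∀ {u v}, (groupGraph {0, a} {0}).Adj u v → ∃ i, Cylinder.ends i = s(f u, f v) := by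
    have key : ∀ x y, Incident {0, a} {0} x y →
        ∃ i, Cylinder.ends i = s(f (.inl x), f (.inr y)) := by
      rintro (i | i) (j | j) h
      · rcases h with h | h
        · obtain rfl := sub_eq_zero.1 h
          exact ⟨((2 * c j, 2 * κ j - 1), false), by simp [Cylinder.ends, f, Sym2.eq_swap]⟩
        · obtain rfl : j = i + a := (sub_eq_iff_eq_add'.1 h)
          refine ⟨((2 * c i, 2 * κ i), false), ?_⟩
          simp only [Cylinder.ends, f, hc, hstep, Bool.false_eq_true, if_false]
          congr 3
          ring
      · obtain rfl := sub_eq_zero.1 h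
        exact ⟨((2 * c j, 2 * κ j), true), by simp [Cylinder.ends, f]⟩
      · obtain rfl := sub_eq_zero.1 h
        exact ⟨((2 * c i, 2 * κ i - 1), true), by simp [Cylinder.ends, f, Sym2.eq_swap]⟩
      · rcases h with h | h
        · obtain rfl := sub_eq_zero.1 h
          exact ⟨((2 * c i + 1, 2 * κ i - 1), false), by simp [Cylinder.ends, f]⟩
        · obtain rfl : i = j + a := (sub_eq_iff_eq_add'.1 h)
          refine ⟨((2 * c j + 1, 2 * κ j), false), ?_⟩
          simp only [Cylinder.ends, f, hc, hstep, Bool.false_eq_true, if_false]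
          rw [Sym2.eq_swap]
          congr 3
          ring
    rintro (x | x) (y | y) h
    · exact h.elim
    · exact key x y h
    · obtain ⟨i, hi⟩ := key y x h
      exact ⟨i, hi.trans Sym2.eq_swap⟩
    · exact h.elim
  refine SimpleGraph.IsPlanar.of_hom (H := (groupGraph {0, a} {0}).map f)
    (Cylinder.isPlanar (by omega) _ ?_) ⟨f, ?_⟩ hf
  · rintro _ _ ⟨-, u, v, h, rfl, rfl⟩
    exact hadj h
  · intro u v h
    exact ⟨fun h' => h.ne (hf h'), u, v, h, rfl, rfl⟩

theorem groupGraph_pair_isPlanar [Finite Γ] {A B : Set Γ} {a₁ a₂ b : Γ} (ha : a₁ ≠ a₂)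
    (hA : A ⊆ {a₁, a₂}) (hB : B ⊆ {b}) : (groupGraph A B).IsPlanar := by
  refine SimpleGraph.IsPlanar.of_hom (SimpleGraph.IsPlanar.of_hom
    (groupGraph_pair_zero_isPlanar (sub_ne_zero.2 ha.symm))
    (groupGraphTranslate _ _ (-a₁) (-b)) (groupGraphTranslate_injective _ _ _ _))
    (SimpleGraph.Hom.ofLE (groupGraph_mono ?_ ?_)) Function.injective_id
  · intro g hg
    rcases hA hg with rfl | rfl
    · simp
    · simp [sub_eq_neg_add]
  · intro g hg
    obtain rfl : g = b := hB hg
    simp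

theorem groupGraph_isPlanar_swap {A B : Set Γ} (h : (groupGraph B A).IsPlanar) :
    (groupGraph A B).IsPlanar :=
  h.of_hom (groupGraphSwap A B) (groupGraphSwap_injective A B)

end TB

/-! ## A program that lists the labelled edges -/

namespace Ram

/-- `k` steps of `P` lead from `s` to `t`, with all memory words on the way at most `W`. -/
def Steps (P : Program) (W : ℕ) (s t : State) (k : ℕ) : Prop :=
  (step P)^[k] s = t ∧ ∀ i ≤ k, ∀ a, ((step P)^[i] s).mem a ≤ W

theorem Steps.refl {P : Program} {W : ℕ} {s : State} (h : ∀ a, s.mem a ≤ W) : Steps P W s s 0 :=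
  ⟨rfl, fun i hi => by rw [Nat.le_zero.1 hi]; exact h⟩

theorem Steps.trans {P : Program} {W : ℕ} {s t u : State} {k k' : ℕ} (h : Steps P W s t k)
    (h' : Steps P W t u k') : Steps P W s u (k + k') := by
  obtain ⟨rfl, h⟩ := h
  obtain ⟨rfl, h'⟩ := h'
  refine ⟨by rw [add_comm, Function.iterate_add_apply], fun i hi => ?_⟩
  rcases Nat.le_total i k with hik | hik
  · exact h i hik
  · obtain ⟨j, rfl⟩ := Nat.exists_eq_add_of_le' hik
    rw [Function.iterate_add_apply]
    exact h' j (by omega)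

theorem Steps.mem_le {P : Program} {W : ℕ} {s t : State} {k : ℕ} (h : Steps P W s t k) (a : ℕ) :
    t.mem a ≤ W := by
  obtain ⟨rfl, h⟩ := h
  exact h k le_rfl a

theorem Steps.single {P : Program} {W : ℕ} {s : State} {i : Instr} (hi : P[s.pc]? = some i)
    (h : ∀ a, s.mem a ≤ W) (h' : ∀ a, (i.exec s).mem a ≤ W) : Steps P W s (i.exec s) 1 := by
  have hs : step P s = i.exec s := by rw [step, hi]
  refine ⟨hs, fun j hj => ?_⟩
  rcases (by omega : j = 0 ∨ j = 1) with rfl | rfl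
  · exact h
  · rw [Function.iterate_one, hs]
    exact h'

theorem getElem?_of_eq_append {α : Type*} {P pre post : List α} {i : α} {k : ℕ}
    (hP : P = pre ++ ([i] ++ post)) (hk : k = pre.length) : P[k]? = some i := by
  rw [hP, hk]
  simp

/-- The instruction does not jump, and the word that it writes to memory is at most `W`. -/
def Instr.Safe (W : ℕ) (s : State) : Instr → Prop
  | .const _ k => k ≤ W
  | .arith o _ a b => o.eval (s.mem a) (s.mem b) ≤ W
  | .read _ => s.input.headD 0 ≤ W
  | .write _ => True
  | _ => False

theorem update_le {M : ℕ → ℕ} {W d k : ℕ} (h : ∀ a, M a ≤ W) (hk : k ≤ W) (a : ℕ) :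
    Function.update M d k a ≤ W := by
  rw [Function.update_apply]
  split_ifs
  · exact hk
  · exact h a

theorem Instr.Safe.mem_le {W : ℕ} {s : State} {i : Instr} (hi : i.Safe W s)
    (h : ∀ a, s.mem a ≤ W) (a : ℕ) : (i.exec s).mem a ≤ W := by
  cases i with
  | const d k => exact update_le h hi a
  | arith o d x y => exact update_le h hi a
  | read d => exact update_le h hi a
  | write x => exact h a
  | load => exact hi.elim
  | store => exact hi.elim
  | jumpIfZero => exact hi.elim

theorem Instr.Safe.pc_eq {W : ℕ} {s : State} {i : Instr} (hi : i.Safe W s) :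
    (i.exec s).pc = s.pc + 1 := by
  cases i <;> first | rfl | exact hi.elim

def SafeBlock (W : ℕ) : List Instr → State → Prop
  | [], _ => True
  | i :: l, s => i.Safe W s ∧ SafeBlock W l (i.exec s)

def runBlock (s : State) (l : List Instr) : State := l.foldl (fun s i => i.exec s) s

/-- Straight-line code can be evaluated by folding, independently of where it stands in the program.
-/
theorem steps_runBlock {P : Program} {W : ℕ} (l pre post : List Instr) (s : State)
    (hP : P = pre ++ (l ++ post)) (hpc : s.pc = pre.length) (hs : ∀ a, s.mem a ≤ W)
    (hl : SafeBlock W l s) :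
    Steps P W s (runBlock s l) l.length ∧ (runBlock s l).pc = pre.length + l.length := by
  induction l generalizing pre s with
  | nil => exact ⟨.refl hs, hpc⟩
  | cons i l ih =>
    obtain ⟨hi, hl⟩ := hl
    have hget : P[s.pc]? = some i := by
      rw [hP, hpc]
      simp
    obtain ⟨h1, h2⟩ := ih (pre ++ [i]) (i.exec s) (by rw [hP]; simp)
      (by rw [hi.pc_eq, hpc, List.length_append, List.length_singleton]) (hi.mem_le hs) hl
    refine ⟨?_, ?_⟩
    · rw [List.length_cons, add_comm]
      exact (Steps.single hget hs (hi.mem_le hs)).trans h1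
    · rw [List.length_cons]
      rw [List.length_append, List.length_singleton] at h2
      change (runBlock (i.exec s) l).pc = _
      omega

end Ram

namespace TB

open Ram

/-- The components of the translation by which a term acts. -/
def shiftFst (l : ℕ) (t : Var × ℕ) : ℕ := (t.1.code + 1) % 2 * t.2 % l

/-- In binary, `code + 1` is 01, 10, 11 for x, y, z: the low bit tells whether `S_l` is a factor,
the high bit whether `S_m` is. -/
def shiftSnd (m : ℕ) (t : Var × ℕ) : ℕ := (t.1.code + 1) / 2 * t.2 % m

/-- Read the `j`-th term and store its translation in the words `20 + 2 j` and `21 + 2 j`. -/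
def readTerm (j : ℕ) : List Instr :=
  [.read 8, .read 9, .arith .add 8 8 7, .arith .mod 10 8 13, .arith .mul 10 10 9,
    .arith .mod (20 + 2 * j) 10 0, .arith .div 8 8 13, .arith .mul 8 8 9,
    .arith .mod (21 + 2 * j) 8 1]

def readTerms : ℕ → ℕ → List Instr
  | _, 0 => []
  | j, k + 1 => readTerm j ++ readTerms (j + 1) k

/-- Write the two edges for the `j`-th term at the current position; `x.1` tells whether the term
belongs to `B`, and `x.2` is the label. -/
def writeTerm (j : ℕ) (x : Bool × ℕ) : List Instr :=
  [.arith .add 8 4 (20 + 2 * j), .arith .mod 8 8 0, .arith .mul 8 8 1,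
    .arith .add 9 5 (21 + 2 * j), .arith .mod 9 9 1, .arith .add 10 8 9, .arith .add 12 2 10,
    .const 14 x.2, .write 3, .write (if x.1 then 12 else 10), .write 14, .write 12,
    .write (if x.1 then 3 else 11), .write 14]

def writeTerms : ℕ → List (Bool × ℕ) → List Instr
  | _, [] => []
  | j, x :: xs => writeTerm j x ++ writeTerms (j + 1) xs

/-- Words 0, 1, 2 hold l, m, l m, and words 7 and 13 the constants 1 and 2. Later, word 3 is the
current position, words 4 and 5 are its coordinates, and word 11 is its index in the second half. -/
def setupCode (spec : List (Bool × ℕ)) : List Instr :=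
  [.read 0, .read 1, .arith .mul 2 0 1, .const 7 1, .const 13 2] ++ readTerms 0 spec.length

def loopHead : List Instr := [.arith .div 4 3 1, .arith .mod 5 3 1, .arith .add 11 2 3]

def loopBody (spec : List (Bool × ℕ)) : List Instr :=
  loopHead ++ (writeTerms 0 spec ++ [.arith .add 3 3 7])

/-- Word 8 receives the number of positions left, and the loop ends when it is 0. Word 6 is never
written and stays 0, so the last jump is unconditional. -/
def program (spec : List (Bool × ℕ)) : Program :=
  setupCode spec ++ (.arith .sub 8 2 3 ::
    .jumpIfZero 8 ((setupCode spec).length + (loopBody spec).length + 3) ::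
    (loopBody spec ++ [.jumpIfZero 6 (setupCode spec).length]))

/-- The number of the image of position `i` under a translation. -/
def target (l m i : ℕ) (t : Var × ℕ) : ℕ :=
  (i / m + shiftFst l t) % l * m + (i % m + shiftSnd m t) % m

def termOutput (l m i : ℕ) (x : Bool × ℕ) (t : Var × ℕ) : List ℕ :=
  let j := target l m i t
  [i, if x.1 then l * m + j else j, x.2, l * m + j, if x.1 then i else l * m + i, x.2]

/-- The words that hold the parameters and are not changed after the first block. -/
def Ready (l m : ℕ) (M : ℕ → ℕ) : Prop :=
  M 0 = l ∧ M 1 = m ∧ M 2 = l * m ∧ M 6 = 0 ∧ M 7 = 1 ∧ M 13 = 2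

/-- The words from `20 + 2 j` on hold the translations for the terms `T`. -/
def Holds (l m : ℕ) (M : ℕ → ℕ) : ℕ → List (Var × ℕ) → Prop
  | _, [] => True
  | j, t :: T => M (20 + 2 * j) = shiftFst l t ∧ M (21 + 2 * j) = shiftSnd m t ∧
      Holds l m M (j + 1) T

theorem Holds.congr {l m : ℕ} {M M' : ℕ → ℕ} {j : ℕ} {T : List (Var × ℕ)} (h : Holds l m M j T)
    (hM : ∀ r, 20 + 2 * j ≤ r → M' r = M r) : Holds l m M' j T := by
  induction T generalizing j with
  | nil => trivial
  | cons t T ih =>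
    exact ⟨(hM _ le_rfl).trans h.1, (hM _ (by omega)).trans h.2.1,
      ih h.2.2 fun r hr => hM r (by omega)⟩

def encode (T : List (Var × ℕ)) : List ℕ := T.flatMap fun t => [t.1.code, t.2]

theorem code_le (v : Var) : v.code ≤ 2 := by cases v <;> decide

theorem code_mod_mul_le (v : Var) (e : ℕ) : (v.code + 1) % 2 * e ≤ e := by
  cases v <;> simp [Var.code]

theorem code_div_mul_le (v : Var) (e : ℕ) : (v.code + 1) / 2 * e ≤ e := by
  cases v <;> simp [Var.code]

theorem readTerm_spec {l m W j : ℕ} {t : Var × ℕ} {s : State} {I : List ℕ}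
    (hM : Ready l m s.mem) (hI : s.input = t.1.code :: t.2 :: I) (hW : 3 ≤ W) (ht : t.2 ≤ W) :
    SafeBlock W (readTerm j) s ∧
      (runBlock s (readTerm j)).mem (20 + 2 * j) = shiftFst l t ∧
      (runBlock s (readTerm j)).mem (21 + 2 * j) = shiftSnd m t ∧
      (∀ r, r ≠ 8 → r ≠ 9 → r ≠ 10 → r ≠ 20 + 2 * j → r ≠ 21 + 2 * j →
        (runBlock s (readTerm j)).mem r = s.mem r) ∧
      (runBlock s (readTerm j)).input = I ∧ (runBlock s (readTerm j)).output = s.output := by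
  obtain ⟨h0, h1, h2, h6, h7, h13⟩ := hM
  have hc := code_le t.1
  have he1 := code_mod_mul_le t.1 t.2
  have he2 := code_div_mul_le t.1 t.2
  have hm1 := Nat.mod_le ((t.1.code + 1) % 2 * t.2) l
  have hm2 := Nat.mod_le ((t.1.code + 1) / 2 * t.2) m
  have n0 : (20 + 2 * j) ≠ 21 + 2 * j := by omega
  have e1 : ∀ k, k < 20 → k ≠ 20 + 2 * j := by omega
  simp only [readTerm, SafeBlock, Instr.Safe, Instr.exec, Arith.eval, runBlock, List.foldl,
    Function.update_apply, hI, List.headD_cons, List.tail_cons, h0, h1, h7, h13, e1, n0,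
    Nat.reduceEqDiff, if_true, if_false, Nat.reduceLT]
  refine ⟨⟨?_, ?_, ?_, ?_, ?_, ?_, ?_, ?_, ?_, trivial⟩, ?_, rfl, ?_, trivial, trivial⟩
  any_goals omega
  · rw [if_neg (by omega), if_neg (by omega)]
    rfl
  · intro r a8 a9 a10 a20 a21
    simp only [a8, a9, a10, a20, a21, if_false]

/-- The clause on words below `20 + 2 * j` says that the translations stored earlier survive the
reading of later terms. -/
theorem steps_readTerms {P : Program} {l m W : ℕ} (hW : 3 ≤ W) (T : List (Var × ℕ)) :
    ∀ (j : ℕ) (pre post : List Instr) (s : State), P = pre ++ (readTerms j T.length ++ post) →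
      s.pc = pre.length → (∀ a, s.mem a ≤ W) → Ready l m s.mem → s.input = encode T →
      (∀ t ∈ T, t.2 ≤ W) →
      ∃ s', Steps P W s s' (9 * T.length) ∧
        s'.pc = pre.length + (readTerms j T.length).length ∧ Holds l m s'.mem j T ∧
        (∀ r < 20 + 2 * j, r ≠ 8 → r ≠ 9 → r ≠ 10 → s'.mem r = s.mem r) ∧
        s'.output = s.output := by
  induction T with
  | nil =>
    intro j pre post s _ hpc hs _ _ _
    exact ⟨s, .refl hs, hpc, trivial, fun _ _ _ _ _ => rfl, rfl⟩
  | cons t T ih =>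
    intro j pre post s hP hpc hs hR hI hT
    have hP' : P = pre ++ (readTerm j ++ (readTerms (j + 1) T.length ++ post)) := by
      rw [hP, List.length_cons, readTerms, List.append_assoc]
    obtain ⟨h1, h2, h3, h4, h5, h6⟩ := readTerm_spec (W := W) (j := j) hR (I := encode T) hI hW
      (hT t List.mem_cons_self)
    obtain ⟨hst, hpc'⟩ := steps_runBlock (readTerm j) pre _ s hP' hpc hs h1
    set s₁ := runBlock s (readTerm j)
    have hR₁ : Ready l m s₁.mem := by
      obtain ⟨r0, r1, r2, r6, r7, r13⟩ := hR
      refine ⟨?_, ?_, ?_, ?_, ?_, ?_⟩ <;>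
        rw [h4 _ (by omega) (by omega) (by omega) (by omega) (by omega)] <;> assumption
    obtain ⟨s', g1, g2, g3, g4, g5⟩ := ih (j + 1) (pre ++ readTerm j) post s₁
      (by rw [hP', List.append_assoc]) (by rw [hpc', List.length_append]) (hst.mem_le) hR₁ h5
      (fun t ht => hT t (List.mem_cons_of_mem _ ht))
    refine ⟨s', ?_, ?_, ⟨?_, ?_, g3⟩, ?_, ?_⟩
    · have := hst.trans g1
      convert this using 1
      simp [readTerm]
      ring
    · rw [g2, List.length_append, List.length_cons, readTerms, List.length_append]
      ring
    · rw [g4 _ (by omega) (by omega) (by omega) (by omega), h2]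
    · rw [g4 _ (by omega) (by omega) (by omega) (by omega), h3]
    · intro r hr h8 h9 h10
      rw [g4 r (by omega) h8 h9 h10, h4 r h8 h9 h10 (by omega) (by omega)]
    · rw [g5, h6]

/-- The words that hold the current position. -/
def AtPosition (l m i : ℕ) (M : ℕ → ℕ) : Prop :=
  M 3 = i ∧ M 4 = i / m ∧ M 5 = i % m ∧ M 11 = l * m + i

theorem writeTerm_spec {l m W i j : ℕ} {x : Bool × ℕ} {t : Var × ℕ} {s : State}
    (hi : i < l * m) (hM : Ready l m s.mem) (hA : AtPosition l m i s.mem)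
    (hu : s.mem (20 + 2 * j) = shiftFst l t) (hv : s.mem (21 + 2 * j) = shiftSnd m t)
    (hx : x.2 ≤ W) (hW : 2 * (l * m) ≤ W) :
    SafeBlock W (writeTerm j x) s ∧
      (∀ r, r ≠ 8 → r ≠ 9 → r ≠ 10 → r ≠ 12 → r ≠ 14 →
        (runBlock s (writeTerm j x)).mem r = s.mem r) ∧
      (runBlock s (writeTerm j x)).output = s.output ++ termOutput l m i x t := by
  obtain ⟨h0, h1, h2, h6, h7, h13⟩ := hM
  obtain ⟨h3, h4, h5, h11⟩ := hA
  have hl : 0 < l := Nat.pos_of_ne_zero fun h => by simp [h] at hi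
  have hm : 0 < m := Nat.pos_of_ne_zero fun h => by simp [h] at hi
  have hlm : l ≤ l * m := Nat.le_mul_of_pos_right l hm
  have hml : m ≤ l * m := Nat.le_mul_of_pos_left m hl
  have hu' : shiftFst l t < l := Nat.mod_lt _ hl
  have hv' : shiftSnd m t < m := Nat.mod_lt _ hm
  have hi1 : i / m < l := Nat.div_lt_of_lt_mul (by rwa [mul_comm])
  have hi2 : i % m < m := Nat.mod_lt _ hm
  have hp : (i / m + shiftFst l t) % l < l := Nat.mod_lt _ hl
  have hq : (i % m + shiftSnd m t) % m < m := Nat.mod_lt _ hm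
  have hpm : (i / m + shiftFst l t) % l * m + m ≤ l * m := by
    calc _ = ((i / m + shiftFst l t) % l + 1) * m := by ring
      _ ≤ l * m := Nat.mul_le_mul_right m hp
  have e : ∀ k, k < 20 → (21 + 2 * j = k ↔ False) := fun k hk =>
    iff_of_false (by omega) id
  obtain ⟨b, lab⟩ := x
  cases b <;>
  · simp only [writeTerm, SafeBlock, Instr.Safe, Instr.exec, Arith.eval, runBlock, List.foldl,
      Function.update_apply, h0, h1, h2, h3, h4, h5, h11, hu, hv, e, Nat.reduceEqDiff,
      if_true, if_false, Nat.reduceLT, Bool.false_eq_true]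
    refine ⟨⟨?_, ?_, ?_, ?_, ?_, ?_, ?_, hx, trivial, trivial, trivial, trivial, trivial, trivial,
      trivial⟩, ?_, ?_⟩
    any_goals omega
    · intro r a8 a9 a10 a12 a14
      simp only [a8, a9, a10, a12, a14, if_false]
    · simp [termOutput, target]

theorem steps_writeTerms {P : Program} {l m W i : ℕ} (hi : i < l * m) (hW : 2 * (l * m) ≤ W)
    (spec : List (Bool × ℕ)) :
    ∀ (T : List (Var × ℕ)) (j : ℕ) (pre post : List Instr) (s : State),
      P = pre ++ (writeTerms j spec ++ post) → s.pc = pre.length → (∀ a, s.mem a ≤ W) →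
      Ready l m s.mem → AtPosition l m i s.mem → Holds l m s.mem j T → T.length = spec.length →
      (∀ x ∈ spec, x.2 ≤ W) →
      ∃ s', Steps P W s s' (14 * spec.length) ∧
        s'.pc = pre.length + (writeTerms j spec).length ∧
        (∀ r, r ≠ 8 → r ≠ 9 → r ≠ 10 → r ≠ 12 → r ≠ 14 → s'.mem r = s.mem r) ∧
        s'.output = s.output ++ (spec.zip T).flatMap fun p => termOutput l m i p.1 p.2 := by
  induction spec with
  | nil =>
    intro T j pre post s _ hpc hs _ _ _ _ _
    exact ⟨s, .refl hs, hpc, fun _ _ _ _ _ _ => rfl, by simp⟩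
  | cons x spec ih =>
    intro T j pre post s hP hpc hs hR hA hH hlen hspec
    obtain _ | ⟨t, T⟩ := T
    · simp at hlen
    obtain ⟨hu, hv, hH⟩ := hH
    have hP' : P = pre ++ (writeTerm j x ++ (writeTerms (j + 1) spec ++ post)) := by
      rw [hP, writeTerms, List.append_assoc]
    obtain ⟨h1, h4, h6⟩ := writeTerm_spec (W := W) (j := j) hi hR hA hu hv
      (hspec x List.mem_cons_self) hW
    obtain ⟨hst, hpc'⟩ := steps_runBlock (writeTerm j x) pre _ s hP' hpc hs h1
    set s₁ := runBlock s (writeTerm j x)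
    have hR₁ : Ready l m s₁.mem := by
      obtain ⟨r0, r1, r2, r6, r7, r13⟩ := hR
      refine ⟨?_, ?_, ?_, ?_, ?_, ?_⟩ <;>
        rw [h4 _ (by omega) (by omega) (by omega) (by omega) (by omega)] <;> assumption
    have hA₁ : AtPosition l m i s₁.mem := by
      obtain ⟨r3, r4, r5, r11⟩ := hA
      refine ⟨?_, ?_, ?_, ?_⟩ <;>
        rw [h4 _ (by omega) (by omega) (by omega) (by omega) (by omega)] <;> assumption
    have hH₁ : Holds l m s₁.mem (j + 1) T := hH.congr fun r hr =>
      h4 r (by omega) (by omega) (by omega) (by omega) (by omega)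
    obtain ⟨s', g1, g2, g4, g5⟩ := ih T (j + 1) (pre ++ writeTerm j x) post s₁
      (by rw [hP', List.append_assoc]) (by rw [hpc', List.length_append]) (hst.mem_le) hR₁ hA₁ hH₁
      (by simpa using hlen) (fun t ht => hspec t (List.mem_cons_of_mem _ ht))
    refine ⟨s', ?_, ?_, ?_, ?_⟩
    · have := hst.trans g1
      convert this using 1
      simp [writeTerm]
      ring
    · rw [g2, List.length_append, writeTerms, List.length_append]
      ring
    · intro r h8 h9 h10 h12 h14
      rw [g4 r h8 h9 h10 h12 h14, h4 r h8 h9 h10 h12 h14]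
    · rw [g5, h6]
      simp

/-- The output of the program. -/
def programOutput (l m : ℕ) (spec : List (Bool × ℕ)) (T : List (Var × ℕ)) : List ℕ :=
  (List.range (l * m)).flatMap fun i => (spec.zip T).flatMap fun p => termOutput l m i p.1 p.2

/-- Induction on the number `n` of positions left. Each round costs 14 steps per term and 7 more:
two for the test, three for the head, one for the increment and one for the jump back. The final 2
is the failing test. -/
theorem steps_loop {l m W : ℕ} (hW : 2 * (l * m) ≤ W) {spec : List (Bool × ℕ)}
    {T : List (Var × ℕ)} (hlen : T.length = spec.length) (hspec : ∀ x ∈ spec, x.2 ≤ W) :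
    ∀ (n i : ℕ) (s : State), i + n = l * m → s.pc = (setupCode spec).length →
      (∀ a, s.mem a ≤ W) → Ready l m s.mem → s.mem 3 = i → Holds l m s.mem 0 T →
      ∃ s', Steps (program spec) W s s' (n * (14 * spec.length + 7) + 2) ∧
        s'.pc = (program spec).length ∧
        s'.output = s.output ++ (List.range' i n).flatMap fun i =>
          (spec.zip T).flatMap fun p => termOutput l m i p.1 p.2 := by
  intro n
  have hget1 : (program spec)[(setupCode spec).length]? = some (.arith .sub 8 2 3) := by
    simp [program]
  have hget2 : (program spec)[(setupCode spec).length + 1]? = some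
      (.jumpIfZero 8 ((setupCode spec).length + (loopBody spec).length + 3)) := by
    simp [program]
  have hget3 : (program spec)[(setupCode spec).length + 2 + (loopBody spec).length]? =
      some (.jumpIfZero 6 (setupCode spec).length) := by
    simp [program, add_assoc, add_comm 2]
  have hlength : (program spec).length = (setupCode spec).length + (loopBody spec).length + 3 := by
    simp [program]
    ring
  induction n with
  | zero =>
    intro i s hi hpc hs hR h3 hH
    obtain ⟨h0, h1, h2, h6, h7, h13⟩ := hR
    have hz : s.mem 2 - s.mem 3 = 0 := by rw [h2, h3]; omega
    have st1 := Steps.single (P := program spec) (W := W) (s := s)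
      (i := .arith .sub 8 2 3) (by rw [hpc]; exact hget1) hs
      (update_le hs (by simp [Arith.eval, hz]))
    set s₁ := Instr.exec s (.arith .sub 8 2 3) with hs₁
    have hpc₁ : s₁.pc = (setupCode spec).length + 1 := by rw [hs₁, ← hpc]; rfl
    have st2 := Steps.single (P := program spec) (W := W) (s := s₁)
      (i := .jumpIfZero 8 ((setupCode spec).length + (loopBody spec).length + 3))
      (by rw [hpc₁]; exact hget2)
      st1.mem_le st1.mem_le
    set s₂ := Instr.exec s₁
      (.jumpIfZero 8 ((setupCode spec).length + (loopBody spec).length + 3)) with hs₂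
    refine ⟨s₂, ?_, ?_, ?_⟩
    · have := st1.trans st2
      convert this using 1
      ring
    · rw [hlength]
      simp [Instr.exec, hs₁, hs₂, Arith.eval, hz]
    · simp [Instr.exec, hs₁, hs₂]
  | succ n ih =>
    intro i s hi hpc hs hR h3 hH
    obtain ⟨h0, h1, h2, h6, h7, h13⟩ := id hR
    have hz : s.mem 2 - s.mem 3 = n + 1 := by rw [h2, h3]; omega
    have st1 := Steps.single (P := program spec) (W := W) (s := s)
      (i := .arith .sub 8 2 3) (by rw [hpc]; exact hget1) hs
      (update_le hs (by simp only [Arith.eval, hz]; omega))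
    set s₁ := Instr.exec s (.arith .sub 8 2 3) with hs₁
    have hpc₁ : s₁.pc = (setupCode spec).length + 1 := by rw [hs₁, ← hpc]; rfl
    have hm₁ : ∀ r, r ≠ 8 → s₁.mem r = s.mem r := fun r hr => Function.update_of_ne hr _ _
    have st2 := Steps.single (P := program spec) (W := W) (s := s₁)
      (i := .jumpIfZero 8 ((setupCode spec).length + (loopBody spec).length + 3))
      (by rw [hpc₁]; exact hget2)
      st1.mem_le st1.mem_le
    set s₂ := Instr.exec s₁
      (.jumpIfZero 8 ((setupCode spec).length + (loopBody spec).length + 3)) with hs₂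
    have hpc₂ : s₂.pc = (setupCode spec).length + 2 := by
      have : s₁.mem 8 ≠ 0 := by simp [hs₁, Instr.exec, Arith.eval, hz]
      simp only [hs₂, Instr.exec, if_neg this, hpc₁]
    have hm₂ : ∀ r, r ≠ 8 → s₂.mem r = s.mem r := hm₁
    have ho₂ : s₂.output = s.output := rfl
    have hP₂ : program spec = (setupCode spec ++ [.arith .sub 8 2 3,
        .jumpIfZero 8 ((setupCode spec).length + (loopBody spec).length + 3)]) ++
        (loopHead ++ (writeTerms 0 spec ++ ([.arith .add 3 3 7] ++
          [.jumpIfZero 6 (setupCode spec).length]))) := by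
      simp [program, loopBody]
    have hmi : i / m ≤ i := Nat.div_le_self i m
    have hmi' : i % m ≤ i := Nat.mod_le i m
    have st3 := steps_runBlock (W := W) loopHead _ _ s₂ hP₂ (by simp [hpc₂]) st2.mem_le (by
      simp only [loopHead, SafeBlock, Instr.Safe, Arith.eval, Instr.exec, Function.update_apply,
        Nat.reduceEqDiff, if_false, hm₂ 3 (by omega), hm₂ 1 (by omega), hm₂ 2 (by omega), h1, h2,
        h3]
      refine ⟨?_, ?_, ?_, trivial⟩ <;> omega)
    have hb₃ : (∀ r, r ≠ 4 → r ≠ 5 → r ≠ 11 → (runBlock s₂ loopHead).mem r = s₂.mem r) ∧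
        (runBlock s₂ loopHead).mem 4 = i / m ∧ (runBlock s₂ loopHead).mem 5 = i % m ∧
        (runBlock s₂ loopHead).mem 11 = l * m + i ∧
        (runBlock s₂ loopHead).output = s₂.output := by
      simp only [runBlock, loopHead, List.foldl, Arith.eval, Instr.exec, Function.update_apply,
        Nat.reduceEqDiff, if_false, if_true, hm₂ 3 (by omega), hm₂ 1 (by omega), hm₂ 2 (by omega),
        h1, h2, h3, and_true]
      intro r a4 a5 a11
      simp only [a4, a5, a11, if_false]
    obtain ⟨st3, hpc₃⟩ := st3
    set s₃ := runBlock s₂ loopHead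
    obtain ⟨hm₃, h34, h35, h311, ho₃⟩ := hb₃
    have hR₃ : Ready l m s₃.mem := by
      refine ⟨?_, ?_, ?_, ?_, ?_, ?_⟩ <;>
        rw [hm₃ _ (by omega) (by omega) (by omega), hm₂ _ (by omega)] <;> assumption
    have hA₃ : AtPosition l m i s₃.mem :=
      ⟨by rw [hm₃ _ (by omega) (by omega) (by omega), hm₂ _ (by omega), h3], h34, h35, h311⟩
    have hH₃ : Holds l m s₃.mem 0 T := hH.congr fun r hr => by
      rw [hm₃ _ (by omega) (by omega) (by omega), hm₂ _ (by omega)]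
    obtain ⟨s₄, st4, hpc₄, hm₄, ho₄⟩ := steps_writeTerms (by omega : i < l * m) hW spec T 0 _ _ s₃
      (hP₂.trans (List.append_assoc _ _ _).symm) (by rw [hpc₃]; simp only [List.length_append]) st3.mem_le
      hR₃ hA₃ hH₃ hlen hspec
    have h43 : s₄.mem 3 = i := by
      rw [hm₄ _ (by omega) (by omega) (by omega) (by omega) (by omega), hA₃.1]
    have hR₄ : Ready l m s₄.mem := by
      obtain ⟨r0, r1, r2, r6, r7, r13⟩ := hR₃
      refine ⟨?_, ?_, ?_, ?_, ?_, ?_⟩ <;>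
        rw [hm₄ _ (by omega) (by omega) (by omega) (by omega) (by omega)] <;> assumption
    have st5 := Steps.single (P := program spec) (W := W) (s := s₄) (i := .arith .add 3 3 7)
      (getElem?_of_eq_append (by rw [hP₂, ← List.append_assoc, ← List.append_assoc])
        (by rw [hpc₄, ← List.length_append]))
      st4.mem_le (update_le st4.mem_le (by
        simp only [Arith.eval, h43, hR₄.2.2.2.2.1]
        omega))
    set s₅ := Instr.exec s₄ (.arith .add 3 3 7) with hs₅
    have hpc₅ : s₅.pc = (setupCode spec).length + 2 + (loopBody spec).length := by
      have : s₅.pc = s₄.pc + 1 := rfl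
      rw [this, hpc₄]
      simp [loopBody]
      ring
    have hm₅ : ∀ r, r ≠ 3 → s₅.mem r = s₄.mem r := fun r hr => Function.update_of_ne hr _ _
    have h53 : s₅.mem 3 = i + 1 := by
      simp [hs₅, Instr.exec, Arith.eval, h43, hR₄.2.2.2.2.1]
    have hR₅ : Ready l m s₅.mem := by
      obtain ⟨r0, r1, r2, r6, r7, r13⟩ := hR₄
      refine ⟨?_, ?_, ?_, ?_, ?_, ?_⟩ <;> rw [hm₅ _ (by omega)] <;> assumption
    have hH₅ : Holds l m s₅.mem 0 T := hH₃.congr fun r hr => by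
      rw [hm₅ _ (by omega), hm₄ _ (by omega) (by omega) (by omega) (by omega) (by omega)]
    have st6 := Steps.single (P := program spec) (W := W) (s := s₅)
      (i := .jumpIfZero 6 (setupCode spec).length) (by rw [hpc₅]; exact hget3)
      st5.mem_le st5.mem_le
    set s₆ := Instr.exec s₅ (.jumpIfZero 6 (setupCode spec).length) with hs₆
    have hpc₆ : s₆.pc = (setupCode spec).length := by
      simp only [hs₆, Instr.exec, if_pos hR₅.2.2.2.1]
    obtain ⟨s', st7, hpc₇, ho₇⟩ := ih (i + 1) s₆ (by omega) hpc₆ st6.mem_le hR₅ h53 hH₅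
    refine ⟨s', ?_, hpc₇, ?_⟩
    · have := (((((st1.trans st2).trans st3).trans st4).trans st5).trans st6).trans st7
      convert this using 1
      simp [loopHead]
      ring
    · rw [ho₇, List.range'_succ, List.flatMap_cons, ← List.append_assoc]
      have : s₆.output = s₄.output := rfl
      rw [this, ho₄, ho₃, ho₂]

theorem program_runsWithin {l m W : ℕ} {spec : List (Bool × ℕ)} {T : List (Var × ℕ)}
    (hlen : T.length = spec.length) (hspec : ∀ x ∈ spec, x.2 ≤ W) (hW : 2 * (l * m) ≤ W)
    (hW3 : 3 ≤ W) (hl : l ≤ W) (hm : m ≤ W) (hT : ∀ t ∈ T, t.2 ≤ W) :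
    RunsWithin (program spec) (l :: m :: encode T) (programOutput l m spec T)
      (5 + 9 * spec.length + (l * m * (14 * spec.length + 7) + 2)) W := by
  let s₀ : State := ⟨0, fun _ => 0, l :: m :: encode T, []⟩
  have hP : program spec = [] ++ ([.read 0, .read 1, .arith .mul 2 0 1, .const 7 1,
      .const 13 2] ++ (readTerms 0 spec.length ++ (.arith .sub 8 2 3 ::
    .jumpIfZero 8 ((setupCode spec).length + (loopBody spec).length + 3) ::
    (loopBody spec ++ [.jumpIfZero 6 (setupCode spec).length])))) := by
    simp [program, setupCode]
  obtain ⟨st1, hpc₁⟩ := steps_runBlock (W := W) _ _ _ s₀ hP rfl (fun _ => Nat.zero_le _) (by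
    simp only [SafeBlock, Instr.Safe, Arith.eval, Instr.exec, Function.update_apply, s₀,
      Nat.reduceEqDiff, if_false, if_true, List.headD_cons, List.tail_cons, zero_ne_one]
    refine ⟨hl, hm, ?_, ?_, ?_, trivial⟩ <;> omega)
  set s₁ := runBlock s₀ [.read 0, .read 1, .arith .mul 2 0 1, .const 7 1, .const 13 2] with hs₁
  have hR₁ : Ready l m s₁.mem ∧ s₁.mem 3 = 0 ∧ s₁.input = encode T ∧ s₁.output = [] := by
    simp [hs₁, runBlock, Instr.exec, Arith.eval, Ready, s₀]
  obtain ⟨hR₁, h13, hI₁, ho₁⟩ := hR₁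
  obtain ⟨s₂, st2, hpc₂, hH₂, hm₂, ho₂⟩ := steps_readTerms (P := program spec) hW3 T 0
    [.read 0, .read 1, .arith .mul 2 0 1, .const 7 1, .const 13 2]
    (.arith .sub 8 2 3 ::
    .jumpIfZero 8 ((setupCode spec).length + (loopBody spec).length + 3) ::
    (loopBody spec ++ [.jumpIfZero 6 (setupCode spec).length])) s₁
    (by rw [hP, hlen, List.nil_append]) (by rw [hpc₁]; rfl) st1.mem_le hR₁ hI₁ hT
  have hR₂ : Ready l m s₂.mem := by
    obtain ⟨r0, r1, r2, r6, r7, r13⟩ := hR₁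
    refine ⟨?_, ?_, ?_, ?_, ?_, ?_⟩ <;>
      rw [hm₂ _ (by omega) (by omega) (by omega) (by omega)] <;> assumption
  obtain ⟨s₃, st3, hpc₃, ho₃⟩ := steps_loop hW hlen hspec (l * m) 0 s₂ (by omega)
    (by rw [hpc₂, hlen, setupCode, List.length_append]) st2.mem_le hR₂
    (by rw [hm₂ _ (by omega) (by omega) (by omega) (by omega), h13]) hH₂
  obtain ⟨hrun, hmem⟩ := (st1.trans st2).trans st3
  refine ⟨_, ?_, ?_, ?_, hmem⟩
  · rw [hlen]
    simp
  · change _ ≤ ((step (program spec))^[_] s₀).pc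
    rw [hrun, hpc₃]
  · change ((step (program spec))^[_] s₀).output = _
    rw [hrun, ho₃, ho₂, ho₁, List.nil_append, programOutput, List.range_eq_range']

end TB

/-! ## The Tanner graph of a trivariate bicycle code -/

namespace TB

/-- The permutation matrix of the translation by `g`. -/
def translationMatrix {Γ : Type*} [AddCommGroup Γ] [DecidableEq Γ] (g : Γ) :
    Matrix Γ Γ (ZMod 2) :=
  Matrix.of fun i j => if j = i + g then 1 else 0

section Translation

variable {Γ Δ : Type*} [AddCommGroup Γ] [DecidableEq Γ] [AddCommGroup Δ] [DecidableEq Δ]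

theorem translationMatrix_zero : translationMatrix (0 : Γ) = 1 := by
  ext i j
  simp [translationMatrix, Matrix.one_apply, eq_comm]

theorem translationMatrix_mul [Fintype Γ] (g h : Γ) :
    translationMatrix g * translationMatrix h = translationMatrix (g + h) := by
  ext i j
  simp only [translationMatrix, Matrix.mul_apply, Matrix.of_apply, ite_mul, one_mul, zero_mul,
    Finset.sum_ite_eq', Finset.mem_univ, if_true, add_assoc]

theorem translationMatrix_pow [Fintype Γ] (g : Γ) (e : ℕ) :
    translationMatrix g ^ e = translationMatrix (e • g) := by
  induction e with
  | zero => rw [pow_zero, zero_nsmul, translationMatrix_zero]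
  | succ e ih => rw [pow_succ, ih, translationMatrix_mul, succ_nsmul]

theorem translationMatrix_kronecker (g : Γ) (h : Δ) :
    translationMatrix g ⊗ₖ translationMatrix h = translationMatrix (g, h) := by
  ext ⟨i, i'⟩ ⟨j, j'⟩
  simp only [Matrix.kroneckerMap_apply, translationMatrix, Matrix.of_apply, Prod.mk_add_mk,
    Prod.mk.injEq, ite_and]
  split_ifs <;> simp

/-- At most one summand is nonzero at a given entry, so no cancellation modulo 2 occurs. -/
theorem sum_translationMatrix_ne_zero {ι : Type*} [Fintype ι] {v : ι → Γ}
    (hv : Function.Injective v) (i j : Γ) :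
    (∑ t, translationMatrix (v t)) i j ≠ 0 ↔ j - i ∈ Set.range v := by
  classical
  have hiff : ∀ t, j = i + v t ↔ v t = j - i := fun t =>
    ⟨fun h => by rw [h, add_sub_cancel_left], fun h => by rw [h, add_sub_cancel]⟩
  simp only [Matrix.sum_apply, translationMatrix, Matrix.of_apply, hiff]
  constructor
  · intro h
    obtain ⟨t, -, ht⟩ := Finset.exists_ne_zero_of_sum_ne_zero h
    exact ⟨t, by by_contra hne; exact ht (if_neg hne)⟩
  · rintro ⟨t, ht⟩
    rw [← ht]
    simp [hv.eq_iff]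

end Translation

variable {l m : ℕ} [NeZero l] [NeZero m]

theorem shift_eq : shift l = translationMatrix (1 : Fin l) := by
  ext i j
  simp only [shift, translationMatrix, Matrix.of_apply, Fin.ext_iff, Fin.val_add, Fin.val_one',
    Nat.add_mod_mod]

/-- The element of the group by which a term translates. -/
def termShift (l m : ℕ) [NeZero l] [NeZero m] (t : Var × ℕ) : Fin l × Fin m :=
  (Fin.ofNat l ((t.1.code + 1) % 2 * t.2), Fin.ofNat m ((t.1.code + 1) / 2 * t.2))

theorem nsmul_one_eq_ofNat (e : ℕ) : e • (1 : Fin l) = Fin.ofNat l e := by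
  induction e with
  | zero => rw [zero_nsmul]; rfl
  | succ e ih =>
    rw [succ_nsmul, ih, Fin.ext_iff, Fin.val_add, Fin.val_one', Fin.val_ofNat, Fin.val_ofNat,
      ← Nat.add_mod]

theorem termMatrix_eq (t : Var × ℕ) :
    termMatrix l m t = translationMatrix (termShift l m t) := by
  obtain ⟨v, e⟩ := t
  cases v <;>
    simp [termMatrix, Var.matrix, shift_eq, ← translationMatrix_zero, translationMatrix_kronecker,
      translationMatrix_pow, nsmul_one_eq_ofNat, termShift, Var.code]

end TB

namespace TBCode

variable {l m wA wB : ℕ} [NeZero l] [NeZero m]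

def aShift (C : TBCode l m wA wB) (j : Fin wA) : Fin l × Fin m := TB.termShift l m (C.aTerm j)

def bShift (C : TBCode l m wA wB) (j : Fin wB) : Fin l × Fin m := TB.termShift l m (C.bTerm j)

theorem aShift_injective (C : TBCode l m wA wB) : Function.Injective C.aShift := by
  intro i j h
  refine C.aTerm_distinct ?_
  simp only [TB.termMatrix_eq]
  exact congrArg _ h

theorem bShift_injective (C : TBCode l m wA wB) : Function.Injective C.bShift := by
  intro i j h
  refine C.bTerm_distinct ?_
  simp only [TB.termMatrix_eq]
  exact congrArg _ h

theorem A_apply_ne_zero (C : TBCode l m wA wB) (i j : Fin l × Fin m) :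
    C.A i j ≠ 0 ↔ j - i ∈ Set.range C.aShift := by
  simp only [A, TB.termMatrix_eq]
  exact TB.sum_translationMatrix_ne_zero C.aShift_injective i j

theorem B_apply_ne_zero (C : TBCode l m wA wB) (i j : Fin l × Fin m) :
    C.B i j ≠ 0 ↔ j - i ∈ Set.range C.bShift := by
  simp only [B, TB.termMatrix_eq]
  exact TB.sum_translationMatrix_ne_zero C.bShift_injective i j

theorem tannerGraph_eq (C : TBCode l m wA wB) :
    C.tannerGraph = TB.groupGraph (Set.range C.aShift) (Set.range C.bShift) := by
  have key : ∀ x y, Matrix.fromRows C.HX C.HZ x y ≠ 0 ↔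
      TB.Incident (Set.range C.aShift) (Set.range C.bShift) x y := by
    rintro (i | i) (j | j)
    · exact C.A_apply_ne_zero i j
    · exact C.B_apply_ne_zero i j
    · exact C.B_apply_ne_zero j i
    · exact C.A_apply_ne_zero j i
  ext (x | x) (y | y)
  · exact Iff.rfl
  · exact key x y
  · exact key y x
  · exact Iff.rfl

/-! ## The decomposition -/

variable (C : TBCode l m wA wB) (labA : Fin wA → Fin 2) (labB : Fin wB → Fin 2)

/-- The graph of the edges that come from the terms with label `k`. -/
def layer (k : Fin 2) : SimpleGraph (Vertex l m) :=
  TB.groupGraph (C.aShift '' {j | labA j = k}) (C.bShift '' {j | labB j = k})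

theorem layer_le (k : Fin 2) : C.layer labA labB k ≤ C.tannerGraph := by
  rw [tannerGraph_eq]
  exact TB.groupGraph_mono (Set.image_subset_range _ _) (Set.image_subset_range _ _)

def layerSubgraph (k : Fin 2) : C.tannerGraph.Subgraph :=
  SimpleGraph.toSubgraph (C.layer labA labB k) (C.layer_le labA labB k)

end TBCode

/-- Each label is given to at most one term on one side and at most two terms on the other. -/
def PlanarLabels {wA wB : ℕ} (labA : Fin wA → Fin 2) (labB : Fin wB → Fin 2) : Prop :=
  ∀ k, (∃ a₁ a₂ b, a₁ ≠ a₂ ∧ (∀ j, labA j = k → j = a₁ ∨ j = a₂) ∧ ∀ j, labB j = k → j = b) ∨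
    ∃ b₁ b₂ a, b₁ ≠ b₂ ∧ (∀ j, labB j = k → j = b₁ ∨ j = b₂) ∧ ∀ j, labA j = k → j = a

namespace TBCode

variable {l m wA wB : ℕ} [NeZero l] [NeZero m]
variable (C : TBCode l m wA wB) {labA : Fin wA → Fin 2} {labB : Fin wB → Fin 2}

theorem layer_isPlanar (h : PlanarLabels labA labB) (k : Fin 2) :
    (C.layer labA labB k).IsPlanar := by
  rcases h k with ⟨a₁, a₂, b, hne, hA, hB⟩ | ⟨b₁, b₂, a, hne, hB, hA⟩
  · refine TB.groupGraph_pair_isPlanar (C.aShift_injective.ne hne) (b := C.bShift b) ?_ ?_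
    · rintro _ ⟨j, hj, rfl⟩
      exact (hA j hj).imp (congrArg _) (congrArg _)
    · rintro _ ⟨j, hj, rfl⟩
      exact congrArg _ (hB j hj)
  · refine TB.groupGraph_isPlanar_swap
      (TB.groupGraph_pair_isPlanar (C.bShift_injective.ne hne) (b := C.aShift a) ?_ ?_)
    · rintro _ ⟨j, hj, rfl⟩
      exact (hB j hj).imp (congrArg _) (congrArg _)
    · rintro _ ⟨j, hj, rfl⟩
      exact congrArg _ (hA j hj)

theorem isPlanarDecomposition_layerSubgraph (h : PlanarLabels labA labB) :
    C.tannerGraph.IsPlanarDecomposition (C.layerSubgraph labA labB) := by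
  have hinc : ∀ x y, TB.Incident (Set.range C.aShift) (Set.range C.bShift) x y →
      ∃ k, TB.Incident (C.aShift '' {j | labA j = k}) (C.bShift '' {j | labB j = k}) x y := by
    rintro (i | i) (j | j) ⟨t, ht⟩ <;> exact ⟨_, t, rfl, ht⟩
  -- An edge determines its translation, hence, by injectivity, its term and its label.
  have hdisj : ∀ x y k k',
      TB.Incident (C.aShift '' {j | labA j = k}) (C.bShift '' {j | labB j = k}) x y →
      TB.Incident (C.aShift '' {j | labA j = k'}) (C.bShift '' {j | labB j = k'}) x y →
      k = k' := by
    rintro (i | i) (j | j) k k' ⟨t, rfl, ht⟩ ⟨t', rfl, ht'⟩ <;> first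
      | rw [C.aShift_injective (ht.trans ht'.symm)]
      | rw [C.bShift_injective (ht.trans ht'.symm)]
  refine ⟨fun k => (C.layer_isPlanar h k).of_hom ⟨Subtype.val, fun h => h⟩
    Subtype.val_injective, ?_, ?_, ?_⟩
  · exact Set.eq_univ_of_forall fun v => Set.mem_iUnion.2 ⟨0, trivial⟩
  · refine Set.Subset.antisymm
      (Set.iUnion_subset fun k => SimpleGraph.Subgraph.edgeSet_subset _) ?_
    intro e he
    rw [Set.mem_iUnion]
    induction e with
    | h u v =>
      rw [tannerGraph_eq] at he
      rcases u with u | u <;> rcases v with v | v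
      · exact he.elim
      · exact hinc u v he
      · exact hinc v u he
      · exact he.elim
  · intro k k' hk
    rw [Set.disjoint_left]
    intro e he he'
    induction e with
    | h u v =>
      rcases u with u | u <;> rcases v with v | v
      · exact he.elim
      · exact hk (hdisj u v k k' he he')
      · exact hk (hdisj v u k k' he he')
      · exact he.elim

theorem tannerGraph_not_isPlanar (hA : 2 ≤ wA) (hB : 2 ≤ wB) : ¬ C.tannerGraph.IsPlanar := by
  rw [tannerGraph_eq]
  refine TB.groupGraph_not_isPlanar
    ⟨_, ⟨⟨0, by omega⟩, rfl⟩, _, ⟨⟨1, by omega⟩, rfl⟩, C.aShift_injective.ne ?_⟩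
    ⟨_, ⟨⟨0, by omega⟩, rfl⟩, _, ⟨⟨1, by omega⟩, rfl⟩, C.bShift_injective.ne ?_⟩ <;> simp

end TBCode

/-! ### Thickness two -/

namespace SimpleGraph

/-- No subgraphs cannot cover a vertex, and a single one would be all of `G`. -/
theorem thickness_eq_two {V : Type*} [Nonempty V] {G : SimpleGraph V} {S : Fin 2 → G.Subgraph}
    (hS : G.IsPlanarDecomposition S) (hG : ¬ G.IsPlanar) : G.thickness = 2 := by
  refine le_antisymm (Nat.sInf_le ⟨S, hS⟩) (le_csInf ⟨2, S, hS⟩ ?_)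
  rintro k ⟨S', hp, hv, he, -⟩
  by_contra hk
  rcases (by omega : k = 0 ∨ k = 1) with rfl | rfl
  · obtain ⟨v⟩ := ‹Nonempty V›
    have : v ∈ ⋃ i, (S' i).verts := hv ▸ Set.mem_univ v
    obtain ⟨i, -⟩ := Set.mem_iUnion.1 this
    exact i.elim0
  · have hv' : ∀ v, v ∈ (S' 0).verts := fun v => by
      have : v ∈ ⋃ i, (S' i).verts := hv ▸ Set.mem_univ v
      obtain ⟨i, hi⟩ := Set.mem_iUnion.1 this
      rwa [Subsingleton.elim 0 i]
    refine hG ((hp 0).of_hom ⟨fun v => ⟨v, hv' v⟩, fun {u v} huv => ?_⟩ fun u v h => by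
      simpa using h)
    have : s(u, v) ∈ ⋃ i, (S' i).edgeSet := he ▸ huv
    obtain ⟨i, hi⟩ := Set.mem_iUnion.1 this
    rw [Subsingleton.elim i 0] at hi
    exact hi

end SimpleGraph

/-! ### Running time and output for a code -/

namespace TBCode

variable {l m wA wB : ℕ}

/-- Over an empty index set all matrices are equal, which contradicts the distinctness of two terms
of `A`. -/
theorem ne_zero (C : TBCode l m wA wB) (hA : 2 ≤ wA) : l ≠ 0 ∧ m ≠ 0 := by
  by_contra h
  have : IsEmpty (Fin l × Fin m) := by
    rcases (by tauto : l = 0 ∨ m = 0) with rfl | rfl <;> infer_instance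
  have h01 := C.aTerm_distinct (a₁ := ⟨0, by omega⟩) (a₂ := ⟨1, by omega⟩) (Subsingleton.elim _ _)
  simp at h01

/-- The terms together with their sides and labels. -/
def labelledTerms (C : TBCode l m wA wB) (labA : Fin wA → Fin 2) (labB : Fin wB → Fin 2) :
    List ((Bool × Fin 2) × (TB.Var × ℕ)) :=
  List.ofFn (fun j => ((false, labA j), C.aTerm j)) ++
    List.ofFn fun j => ((true, labB j), C.bTerm j)

/-- The labels as they are written into the program. -/
def labelSpec (labA : Fin wA → Fin 2) (labB : Fin wB → Fin 2) : List (Bool × ℕ) :=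
  List.ofFn (fun j => (false, (labA j : ℕ))) ++ List.ofFn fun j => (true, (labB j : ℕ))

theorem labelSpec_eq (C : TBCode l m wA wB) (labA : Fin wA → Fin 2) (labB : Fin wB → Fin 2) :
    labelSpec labA labB =
      (C.labelledTerms labA labB).map fun d => (d.1.1, (d.1.2 : ℕ)) := by
  simp [labelSpec, labelledTerms, List.map_ofFn, Function.comp_def]

theorem terms_eq (C : TBCode l m wA wB) (labA : Fin wA → Fin 2) (labB : Fin wB → Fin 2) :
    List.ofFn C.aTerm ++ List.ofFn C.bTerm = (C.labelledTerms labA labB).map fun d => d.2 := by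
  simp [labelledTerms, List.map_ofFn, Function.comp_def]

/-- With w terms the step count is 7 + 9w + l m (14w + 7). As l m ≥ 1, this is at most (14 + 23w) l
m. -/
theorem runsWithin (C : TBCode l m wA wB) (hA : 2 ≤ wA) (labA : Fin wA → Fin 2)
    (labB : Fin wB → Fin 2) :
    Ram.RunsWithin (TB.program (labelSpec labA labB)) C.input
      (TB.programOutput l m (labelSpec labA labB) (List.ofFn C.aTerm ++ List.ofFn C.bTerm))
      ((14 + 23 * (wA + wB)) * C.n) ((14 + 23 * (wA + wB)) * (C.n + C.input.sum)) := by
  obtain ⟨hl, hm⟩ := C.ne_zero hA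
  have hlm : 1 ≤ l * m := Nat.one_le_iff_ne_zero.2 (mul_ne_zero hl hm)
  have hn : C.n = 2 * (l * m) := mul_assoc 2 l m
  have hsum : ∀ x ∈ C.input, x ≤ C.input.sum := fun x hx => List.le_sum_of_mem hx
  set W := (14 + 23 * (wA + wB)) * (C.n + C.input.sum)
  have hW : 14 * (C.n + C.input.sum) ≤ W := Nat.mul_le_mul_right _ (by omega)
  have hlen : (labelSpec labA labB).length = wA + wB := by simp [labelSpec]
  have hin : C.input = l :: m :: TB.encode (List.ofFn C.aTerm ++ List.ofFn C.bTerm) := rfl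
  obtain ⟨t, ht, h⟩ := TB.program_runsWithin (l := l) (m := m) (W := W)
    (spec := labelSpec labA labB) (T := List.ofFn C.aTerm ++ List.ofFn C.bTerm)
    (by rw [hlen]; simp) (by
      intro x hx
      have : x.2 ≤ 1 := by
        simp only [labelSpec, List.mem_append, List.mem_ofFn] at hx
        rcases hx with ⟨j, rfl⟩ | ⟨j, rfl⟩ <;> dsimp only <;> omega
      omega) (by omega) (by omega)
    (by have := hsum l (by simp [hin]); omega) (by have := hsum m (by simp [hin]); omega) (by
      intro t ht
      have := hsum t.2 (by
        rw [hin]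
        refine List.mem_cons_of_mem _ (List.mem_cons_of_mem _ (List.mem_flatMap.2 ⟨t, ht, ?_⟩))
        simp)
      omega)
  refine ⟨t, ht.trans ?_, h⟩
  rw [hlen, hn]
  nlinarith [Nat.mul_le_mul_left (wA + wB) hlm]

/-- The two edges that the translation `u.2` on side `u.1.1` contributes at position `p`. -/
def layerEdge (x : (Fin l × Fin m) × ((Bool × Fin 2) × (Fin l × Fin m)) × Bool) :
    ((Fin l × Fin m) ⊕ (Fin l × Fin m)) × ((Fin l × Fin m) ⊕ (Fin l × Fin m)) × Fin 2 :=
  match x with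
  | (p, ((b, k), g), false) => (.inl p, if b then .inr (p + g) else .inl (p + g), k)
  | (p, ((b, k), g), true) => (.inr (p + g), if b then .inl p else .inr p, k)

theorem layerEdge_injective : Function.Injective (layerEdge (l := l) (m := m)) := by
  rintro ⟨p, ⟨⟨b, k⟩, g⟩, c⟩ ⟨p', ⟨⟨b', k'⟩, g'⟩, c'⟩ h
  cases c <;> cases c' <;> cases b <;> cases b' <;> simp [layerEdge] at h <;>
    obtain ⟨h1, h2, h3⟩ := h <;> simp_all

variable [NeZero l] [NeZero m]

/-- All edges with their labels, in the order in which the program lists them. -/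
def edgeList (C : TBCode l m wA wB) (labA : Fin wA → Fin 2) (labB : Fin wB → Fin 2) :
    List (((Fin l × Fin m) ⊕ (Fin l × Fin m)) × ((Fin l × Fin m) ⊕ (Fin l × Fin m)) × Fin 2) :=
  (((List.finRange (l * m)).map finProdFinEquiv.symm).product
    (((C.labelledTerms labA labB).map fun d => (d.1, TB.termShift l m d.2)).product
      [false, true])).map layerEdge

theorem mem_shifts (C : TBCode l m wA wB) (labA : Fin wA → Fin 2) (labB : Fin wB → Fin 2)
    (b : Bool) (k : Fin 2) (g : Fin l × Fin m) :
    ((b, k), g) ∈ (C.labelledTerms labA labB).map (fun d => (d.1, TB.termShift l m d.2)) ↔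
      if b then g ∈ C.bShift '' {j | labB j = k} else g ∈ C.aShift '' {j | labA j = k} := by
  cases b <;>
    simp [labelledTerms, List.map_ofFn, List.mem_ofFn, aShift, bShift, Function.comp_def]

theorem nodup_edgeList (C : TBCode l m wA wB) (labA : Fin wA → Fin 2) (labB : Fin wB → Fin 2) :
    (C.edgeList labA labB).Nodup := by
  refine ((((List.nodup_finRange _).map finProdFinEquiv.symm.injective).product
    (List.Nodup.product ?_ (by decide))).map layerEdge_injective)
  simp only [labelledTerms, List.map_append, List.map_ofFn]
  refine List.Nodup.append (List.nodup_ofFn.2 ?_) (List.nodup_ofFn.2 ?_) ?_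
  · exact fun i j h => C.aShift_injective (Prod.ext_iff.1 h).2
  · exact fun i j h => C.bShift_injective (Prod.ext_iff.1 h).2
  · intro x hx hx'
    obtain ⟨i, rfl⟩ := List.mem_ofFn.1 hx
    obtain ⟨j, hj⟩ := List.mem_ofFn.1 hx'
    simp at hj

theorem mem_edgeList (C : TBCode l m wA wB) (labA : Fin wA → Fin 2) (labB : Fin wB → Fin 2)
    (c q : (Fin l × Fin m) ⊕ (Fin l × Fin m)) (k : Fin 2) :
    (c, q, k) ∈ C.edgeList labA labB ↔
      (C.layerSubgraph labA labB k).Adj (.inl c) (.inr q) := by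
  have hps : ∀ p, p ∈ (List.finRange (l * m)).map finProdFinEquiv.symm := fun p =>
    List.mem_map.2 ⟨finProdFinEquiv p, List.mem_finRange _, Equiv.symm_apply_apply _ _⟩
  have hmem : (c, q, k) ∈ C.edgeList labA labB ↔ ∃ p b g e, ((b, k), g) ∈
      (C.labelledTerms labA labB).map (fun d => (d.1, TB.termShift l m d.2)) ∧
        layerEdge (p, ((b, k), g), e) = (c, q, k) := by
    constructor
    · intro h
      obtain ⟨⟨p, ⟨⟨b, k'⟩, g⟩, e⟩, hx, hx'⟩ := List.mem_map.1 h
      have hk : k' = k := by cases e <;> exact (Prod.ext_iff.1 (Prod.ext_iff.1 hx').2).2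
      subst hk
      exact ⟨p, b, g, e, (List.pair_mem_product.1 (List.pair_mem_product.1 hx).2).1, hx'⟩
    · rintro ⟨p, b, g, e, h, he⟩
      exact List.mem_map.2 ⟨_, List.pair_mem_product.2 ⟨hps p, List.pair_mem_product.2
        ⟨h, by cases e <;> simp⟩⟩, he⟩
  have hadj : (C.layerSubgraph labA labB k).Adj (.inl c) (.inr q) ↔
      TB.Incident (C.aShift '' {j | labA j = k}) (C.bShift '' {j | labB j = k}) c q := Iff.rfl
  rw [hmem, hadj]
  simp only [mem_shifts]
  constructor
  · rintro ⟨p, b, g, e, hg, he⟩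
    cases e <;> cases b <;> simp only [layerEdge, Prod.mk.injEq, if_true, Bool.false_eq_true,
      if_false] at he hg <;> obtain ⟨rfl, rfl, -⟩ := he <;>
      simpa only [TB.Incident, add_sub_cancel_left] using hg
  · intro h
    rcases c with i | i <;> rcases q with j | j
    · exact ⟨i, false, j - i, false, by rw [if_neg Bool.false_ne_true]; exact h, by simp [layerEdge]⟩
    · exact ⟨i, true, j - i, false, by rw [if_pos rfl]; exact h, by simp [layerEdge]⟩
    · exact ⟨j, true, i - j, true, by rw [if_pos rfl]; exact h, by simp [layerEdge]⟩
    · exact ⟨j, false, i - j, true, by rw [if_neg Bool.false_ne_true]; exact h, by simp [layerEdge]⟩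

theorem programOutput_eq (C : TBCode l m wA wB) (labA : Fin wA → Fin 2)
    (labB : Fin wB → Fin 2) :
    TB.programOutput l m (labelSpec labA labB) (List.ofFn C.aTerm ++ List.ofFn C.bTerm) =
      (C.edgeList labA labB).flatMap fun e => [index e.1, index e.2.1, (e.2.2 : ℕ)] := by
  -- Addition in the group agrees with the arithmetic on indices that the program performs.
  have hval : ∀ (p : Fin l × Fin m) (t : TB.Var × ℕ),
      ((p + TB.termShift l m t).1 : ℕ) * m + (p + TB.termShift l m t).2 =
        TB.target l m (p.1 * m + p.2) t := by
    intro p t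
    have hm : 0 < m := Nat.pos_of_neZero m
    have h1 : ((p.1 : ℕ) * m + p.2) / m = p.1 := by
      rw [mul_comm, Nat.mul_add_div hm, Nat.div_eq_of_lt p.2.2, add_zero]
    have h2 : ((p.1 : ℕ) * m + p.2) % m = p.2 := by
      rw [mul_comm, Nat.mul_add_mod, Nat.mod_eq_of_lt p.2.2]
    rw [TB.target, h1, h2]
    rfl
  rw [TB.programOutput, labelSpec_eq C, terms_eq C labA labB, List.zip_map',
    ← List.map_coe_finRange_eq_range, edgeList]
  simp only [List.flatMap_map, List.product, List.flatMap_assoc, List.flatMap_cons,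
    List.flatMap_nil, List.map_cons, List.map_nil, List.append_nil]
  refine List.flatMap_congr fun i _ => List.flatMap_congr fun d _ => ?_
  obtain ⟨p, rfl⟩ := finProdFinEquiv.surjective i
  have hi : ((finProdFinEquiv p : Fin (l * m)) : ℕ) = p.1 * m + p.2 := by
    simp [finProdFinEquiv, add_comm, mul_comm]
  obtain ⟨⟨b, k⟩, t⟩ := d
  rw [hi, Equiv.symm_apply_apply]
  cases b <;> simp [TB.termOutput, layerEdge, index, ← hval]

theorem isOutput (C : TBCode l m wA wB) (labA : Fin wA → Fin 2) (labB : Fin wB → Fin 2) :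
    C.IsOutput (C.layerSubgraph labA labB)
      (TB.programOutput l m (labelSpec labA labB) (List.ofFn C.aTerm ++ List.ofFn C.bTerm)) :=
  ⟨C.edgeList labA labB, C.nodup_edgeList labA labB, C.mem_edgeList labA labB,
    C.programOutput_eq labA labB⟩

end TBCode

theorem thickness_and_program {wA wB : ℕ} (hA : 2 ≤ wA) (hB : 2 ≤ wB) {labA : Fin wA → Fin 2}
    {labB : Fin wB → Fin 2} (h : PlanarLabels labA labB) :
    (∀ (l m : ℕ) (C : TBCode l m wA wB), C.tannerGraph.thickness = 2) ∧
    ∃ (P : Ram.Program) (c : ℕ), ∀ (l m : ℕ) (C : TBCode l m wA wB),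
      ∃ (S : Fin 2 → C.tannerGraph.Subgraph) (out : List ℕ),
        C.tannerGraph.IsPlanarDecomposition S ∧ C.IsOutput S out ∧
        Ram.RunsWithin P C.input out (c * C.n) (c * (C.n + C.input.sum)) := by
  refine ⟨fun l m C => ?_, TB.program (TBCode.labelSpec labA labB), 14 + 23 * (wA + wB),
    fun l m C => ?_⟩ <;> obtain ⟨hl, hm⟩ := C.ne_zero hA <;> have : NeZero l := ⟨hl⟩ <;>
    have : NeZero m := ⟨hm⟩
  · exact SimpleGraph.thickness_eq_two (C.isPlanarDecomposition_layerSubgraph h)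
      (C.tannerGraph_not_isPlanar hA hB)
  · exact ⟨_, _, C.isPlanarDecomposition_layerSubgraph h, C.isOutput labA labB,
      C.runsWithin hA labA labB⟩

theorem mainTheorem1 (wA wB : ℕ)
    (hw : (wA, wB) ∈ ({(2, 2), (2, 3), (3, 3), (2, 4)} : Set (ℕ × ℕ))) :
    (∀ (l m : ℕ) (C : TBCode l m wA wB), C.tannerGraph.thickness = 2) ∧
    ∃ (P : Ram.Program) (c : ℕ), ∀ (l m : ℕ) (C : TBCode l m wA wB),
      ∃ (S : Fin 2 → C.tannerGraph.Subgraph) (out : List ℕ),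
        C.tannerGraph.IsPlanarDecomposition S ∧ C.IsOutput S out ∧
        Ram.RunsWithin P C.input out (c * C.n) (c * (C.n + C.input.sum)) := by
  simp only [Set.mem_insert_iff, Set.mem_singleton_iff, Prod.mk.injEq] at hw
  rcases hw with ⟨rfl, rfl⟩ | ⟨rfl, rfl⟩ | ⟨rfl, rfl⟩ | ⟨rfl, rfl⟩
  -- In all four cases label 0 takes two terms from one side and one from the other. The remaining
  -- terms, which get label 1, again number at most two on one side and at most one on the other.
  · exact thickness_and_program (by omega) (by omega) (labA := ![0, 1]) (labB := ![0, 0])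
      (by unfold PlanarLabels; decide)
  · exact thickness_and_program (by omega) (by omega) (labA := ![0, 1]) (labB := ![0, 0, 1])
      (by unfold PlanarLabels; decide)
  · exact thickness_and_program (by omega) (by omega) (labA := ![0, 0, 1]) (labB := ![0, 1, 1])
      (by unfold PlanarLabels; decide)
  · exact thickness_and_program (by omega) (by omega) (labA := ![0, 1]) (labB := ![0, 0, 1, 1])
      (by unfold PlanarLabels; decide)
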